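/- Let $\pi:E\to M$ be a smooth fibred manifold (surjective submersion, e.g. a fibre bundle), $\dim M=n$, $\dim E=n+k$, and let $\omega$ be a volume form on $M$. Let $J^1\pi$ be the first jet bundle, i.e. the manifold of linear right inverses $\tau:T_{\pi(e)}M\to T_eE$ of $\pi_*(e)$, with projections $\pi_{1,0}:J^1\pi\to E$ and $\pi_1:J^1\pi\to M$. Let $\lambda:L_\pi E\to E$ be the adapted frame bundle, whose points are the bases $u=(e_1,\dots,e_n,e_{n+1},\dots,e_{n+k})$ of $T_eE$ with $\pi_*(e_A)=0$ for the last $k$ vectors. Below $i,j$ run over the first $n$ indices and $A,B$ over the last $k$. Let $\rho:L_\pi E\to J^1\pi$ send $u$ to the jet $\tau$ with $\tau(\pi_*e_i)=e_i$. The group of invertible block lower triangular matrices acts on $L_\pi E$ on the right, and $E^{*i}_j$, $E^{*A}_B$, $E^{*i}_B$ denote the fundamental vector fields of the elementary matrices, $\xi^*(u)=\frac{d}{dt}\big|_{0}\,u\cdot\exp(t\xi)$; to first order their flows replace $e_i$ by $e_i+te_j$, $e_A$ by $e_A+te_B$ and $e_i$ by $e_i+te_B$, respectively. Let $(\theta^i,\theta^A)$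 be the soldering form, i.e. the components of $\lambda_*X$ in the frame $u$, and let $B_1,\dots,B_n$ be vector fields on $L_\pi E$ with $\lambda_*(B_i(u))=e_i$ (for instance the standard horizontal vector fields of a linear connection). *The form on $J^1\pi$.* For a $1$-form $\alpha$ on $M$ let $S_\alpha(X)=\alpha\odot\omega^1(X)$, where $\omega^1(X)=v-\tau(\pi_*v)$ with $v=(\pi_{1,0})_*X$, and $\alpha\odot\xi$ is the tangent vector at $t=0$ to the curve $\tau+t\,\alpha\otimes\xi$. For a covector $\sigma$ on $J^1\pi$ define $S\sigma$ by $\alpha((S\sigma)(X))=\sigma(S_\alpha(X))$ for all $\alpha$, and define the vector-valued $n$-form $S_\omega$ by $$\sigma(S_\omega(X_1,\dots,X_n))=\sum_{i=1}^n\omega\big((\pi_1)_*X_1,\dots,(S\sigma)(X_i),\dots,(\pi_1)_*X_n\big)\quad\text{for all }\sigma .$$ For $\mathcal L:J^1\pi\to\mathbb R$ put $\Theta_{\mathcal L}=\mathcal L\,\omega+d\mathcal L\circ S_\omega$ (with $\omega$ pulled back to $J^1\pi$), the Cartan–Hamilton–Poincaré $n$-form. *The form on $L_\pi E$.* Let $\tilde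 S_\alpha=\sum_{i,B}\big((\pi\circ\lambda)^*\alpha\big)(B_i)\,E^{*i}_B\otimes\theta^B$, define $\tilde S\sigma$ and $\tilde S_\omega$ from $\tilde S_\alpha$ and $\pi\circ\lambda$ by the same two formulas, and put $\theta_L=L\,\omega+dL\circ\tilde S_\omega$ for $L:L_\pi E\to\mathbb R$ (with $\omega$ pulled back to $L_\pi E$). **Proposition.** Let $L:L_\pi E\to\mathbb R$ be a smooth lifted Lagrangian, that is, $E^{*i}_j(L)=0$ and $E^{*A}_B(L)=0$ for all $i,j,A,B$. 1. If $\mathcal L:J^1\pi\to\mathbb R$ satisfies $\rho^*\mathcal L=L$, then $\mathcal L$ is smooth and $\rho^*\Theta_{\mathcal L}=\theta_L$. 2. If $L$ is constant on the fibres of $\rho$, there is exactly one $\mathcal L$ with $\rho^*\mathcal L=L$. 3. In general, every $u_0\in L_\pi E$ has an open neighbourhood $U$ with $\rho(U)$ open such that there is a smooth function $\mathcal L$ on $\rho(U)$ with $\rho^*\mathcal L=L$ and $\rho^*\Theta_{\mathcal L}=\theta_L$ on $U$. -/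

import Mathlib

open scoped Manifold ContDiff Topology

noncomputable section

namespace FieldTheory

/-- `ℝᵐ` with its standard coordinates. -/
abbrev Rn (m : ℕ) : Type := EuclideanSpace ℝ (Fin m)

instance instFiniteDimensionalTangentSpace {V : Type*} [NormedAddCommGroup V] [NormedSpace ℝ V]
    [FiniteDimensional ℝ V] {X : Type*} [TopologicalSpace X] [ChartedSpace V X] (x : X) :
    FiniteDimensional ℝ (TangentSpace 𝓘(ℝ, V) x) :=
  inferInstanceAs (FiniteDimensional ℝ V)

/-- A smooth fibred manifold `π : E → M` (a surjective submersion) with `dim M = n` and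
`dim E = n + k`. In particular, every smooth fibre bundle is one. -/
structure FiberedManifold (n k : ℕ) (M E : Type*)
    [TopologicalSpace M] [ChartedSpace (Rn n) M] [TopologicalSpace E]
    [ChartedSpace (Rn n × Rn k) E] where
  /-- the projection `π` -/
  proj : E → M
  surjective : Function.Surjective proj
  isSubmersion : Manifold.IsSubmersion 𝓘(ℝ, Rn n × Rn k) 𝓘(ℝ, Rn n) ∞ proj

section

variable {n k : ℕ} {M E : Type*}
  [TopologicalSpace M] [ChartedSpace (Rn n) M] [TopologicalSpace E]
  [ChartedSpace (Rn n × Rn k) E]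

/-- The differential `π_*(e) : T_e E → T_{π(e)} M`. -/
abbrev FiberedManifold.dproj (P : FiberedManifold n k M E) (e : E) :
    TangentSpace 𝓘(ℝ, Rn n × Rn k) e →L[ℝ] TangentSpace 𝓘(ℝ, Rn n) (P.proj e) :=
  mfderiv 𝓘(ℝ, Rn n × Rn k) 𝓘(ℝ, Rn n) P.proj e

/-! ### Adapted coordinates -/

/-- Adapted coordinates: a chart `(xⁱ, yᴬ)` of `E` and a chart `(xⁱ)` of `M` in which the
projection is `(x, y) ↦ x`. -/
structure AdaptedChart (P : FiberedManifold n k M E) where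
  top : OpenPartialHomeomorph E (Rn n × Rn k)
  bot : OpenPartialHomeomorph M (Rn n)
  top_mem : top ∈ IsManifold.maximalAtlas 𝓘(ℝ, Rn n × Rn k) ∞ E
  bot_mem : bot ∈ IsManifold.maximalAtlas 𝓘(ℝ, Rn n) ∞ M
  maps : ∀ e ∈ top.source, P.proj e ∈ bot.source
  comm : ∀ e ∈ top.source, bot (P.proj e) = (top e).1

theorem exists_adaptedChart [IsManifold 𝓘(ℝ, Rn n × Rn k) ∞ E] (P : FiberedManifold n k M E)
    (e : E) : ∃ c : AdaptedChart P, e ∈ c.top.source := by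
  obtain ⟨F, _, _, hF⟩ := P.isSubmersion
  have h := hF e
  set eq := h.equiv
  have hfd : FiniteDimensional ℝ (Rn n × F) := eq.toLinearEquiv.finiteDimensional
  have : FiniteDimensional ℝ F :=
    FiniteDimensional.of_surjective (LinearMap.snd ℝ (Rn n) F) LinearMap.snd_surjective
  have hdim : Module.finrank ℝ F = Module.finrank ℝ (Rn k) := by
    have := eq.toLinearEquiv.finrank_eq
    rw [Module.finrank_prod, Module.finrank_prod] at this
    omega
  let g : F ≃L[ℝ] Rn k := ContinuousLinearEquiv.ofFinrankEq hdim
  let s : (Rn n × Rn k) ≃L[ℝ] (Rn n × Rn k) :=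
    eq.trans ((ContinuousLinearEquiv.refl ℝ (Rn n)).prodCongr g)
  have hs1 : ∀ z, (s z).1 = (eq z).1 := fun z => rfl
  refine ⟨⟨h.domChart.trans s.toHomeomorph.toOpenPartialHomeomorph, h.codChart, ?_,
    h.codChart_mem_maximalAtlas, ?_, ?_⟩, ?_⟩
  · apply OpenPartialHomeomorph.mem_maximalAtlas_of_contMDiffOn
    · have h1 := contMDiffOn_of_mem_maximalAtlas h.domChart_mem_maximalAtlas
      have h2 : ContMDiff 𝓘(ℝ, Rn n × Rn k) 𝓘(ℝ, Rn n × Rn k) ∞ s :=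
        s.contDiff.contMDiff
      simpa using h2.comp_contMDiffOn h1
    · have h1 := contMDiffOn_symm_of_mem_maximalAtlas h.domChart_mem_maximalAtlas
      have h2 : ContMDiff 𝓘(ℝ, Rn n × Rn k) 𝓘(ℝ, Rn n × Rn k) ∞ s.symm :=
        s.symm.contDiff.contMDiff
      refine h1.comp h2.contMDiffOn ?_
      intro z hz
      simpa using hz
  · intro e' he'
    apply h.mapsto_domChart_source_codChart_source
    simpa using he'
  · intro e' he'
    have he'' : e' ∈ h.domChart.source := by simpa using he'
    have hm : h.domChart e' ∈ (h.domChart.extend 𝓘(ℝ, Rn n × Rn k)).target := by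
      simpa using h.domChart.map_source he''
    have := h.writtenInCharts hm
    simpa [he'', hs1] using this
  · simpa using h.mem_domChart_source

/-- The differential of the coordinates `(xⁱ, yᴬ)` at `e`. -/
def AdaptedChart.dtop {P : FiberedManifold n k M E} (c : AdaptedChart P) (e : E) :
    TangentSpace 𝓘(ℝ, Rn n × Rn k) e →L[ℝ] Rn n × Rn k :=
  mfderiv 𝓘(ℝ, Rn n × Rn k) 𝓘(ℝ, Rn n × Rn k) c.top e

/-- The differential of the coordinates `(xⁱ)` at `x`. -/
def AdaptedChart.dbot {P : FiberedManifold n k M E} (c : AdaptedChart P) (x : M) :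
    TangentSpace 𝓘(ℝ, Rn n) x →L[ℝ] Rn n :=
  mfderiv 𝓘(ℝ, Rn n) 𝓘(ℝ, Rn n) c.bot x

section AdaptedChart

variable {P : FiberedManifold n k M E} (c : AdaptedChart P)


theorem AdaptedChart.top_mdifferentiable :
    c.top.MDifferentiable 𝓘(ℝ, Rn n × Rn k) 𝓘(ℝ, Rn n × Rn k) :=
  ⟨(contMDiffOn_of_mem_maximalAtlas c.top_mem).mdifferentiableOn (by simp),
    (contMDiffOn_symm_of_mem_maximalAtlas c.top_mem).mdifferentiableOn (by simp)⟩

theorem AdaptedChart.bot_mdifferentiable : c.bot.MDifferentiable 𝓘(ℝ, Rn n) 𝓘(ℝ, Rn n) :=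
  ⟨(contMDiffOn_of_mem_maximalAtlas c.bot_mem).mdifferentiableOn (by simp),
    (contMDiffOn_symm_of_mem_maximalAtlas c.bot_mem).mdifferentiableOn (by simp)⟩

theorem AdaptedChart.dtop_isInvertible {e : E} (he : e ∈ c.top.source) :
    (c.dtop e).IsInvertible := ⟨c.top_mdifferentiable.mfderiv he, rfl⟩

theorem AdaptedChart.dbot_isInvertible {x : M} (hx : x ∈ c.bot.source) :
    (c.dbot x).IsInvertible := ⟨c.bot_mdifferentiable.mfderiv hx, rfl⟩

theorem FiberedManifold.mdifferentiableAt_proj (P : FiberedManifold n k M E) (e : E) :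
    MDifferentiableAt 𝓘(ℝ, Rn n × Rn k) 𝓘(ℝ, Rn n) P.proj e := by
  obtain ⟨F, _, _, hF⟩ := P.isSubmersion
  exact (hF e).contMDiffAt.mdifferentiableAt (by simp)

theorem AdaptedChart.dbot_dproj {e : E} (he : e ∈ c.top.source)
    (X : TangentSpace 𝓘(ℝ, Rn n × Rn k) e) :
    c.dbot (P.proj e) (P.dproj e X) = (c.dtop e X).1 := by
  have h1 : HasMFDerivAt 𝓘(ℝ, Rn n × Rn k) 𝓘(ℝ, Rn n) (c.bot ∘ P.proj) e
      ((c.dbot (P.proj e)).comp (P.dproj e)) :=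
    (c.bot_mdifferentiable.mdifferentiableAt (c.maps e he)).hasMFDerivAt.comp e
      (P.mdifferentiableAt_proj e).hasMFDerivAt
  have h2 : HasMFDerivAt 𝓘(ℝ, Rn n × Rn k) 𝓘(ℝ, Rn n) (Prod.fst ∘ c.top) e
      ((ContinuousLinearMap.fst ℝ (Rn n) (Rn k)).comp (c.dtop e)) :=
    (ContinuousLinearMap.fst ℝ (Rn n) (Rn k)).hasMFDerivAt.comp e
      (c.top_mdifferentiable.mdifferentiableAt he).hasMFDerivAt
  have h3 : Prod.fst ∘ c.top =ᶠ[𝓝 e] c.bot ∘ P.proj := by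
    filter_upwards [c.top.open_source.mem_nhds he] with e' he'
    exact (c.comm e' he').symm
  have := hasMFDerivAt_unique h1 (h2.congr_of_eventuallyEq h3.symm)
  exact DFunLike.congr_fun this X

/-- Domain of the change of adapted coordinates, in the coordinates of `c`. -/
def AdaptedChart.overlap (c c' : AdaptedChart P) : Set (Rn n × Rn k) :=
  (c.top.symm.trans c'.top).source

theorem AdaptedChart.isOpen_overlap (c c' : AdaptedChart P) : IsOpen (c.overlap c') :=
  (c.top.symm.trans c'.top).open_source

theorem AdaptedChart.contDiffOn_top (c c' : AdaptedChart P) :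
    ContDiffOn ℝ ∞ (c'.top ∘ c.top.symm) (c.overlap c') := by
  rw [← contMDiffOn_iff_contDiffOn]
  refine (contMDiffOn_of_mem_maximalAtlas c'.top_mem).comp
    ((contMDiffOn_symm_of_mem_maximalAtlas c.top_mem).mono ?_) ?_
  · intro z hz
    exact hz.1
  · intro z hz
    exact hz.2

theorem AdaptedChart.contDiffOn_bot (c c' : AdaptedChart P) :
    ContDiffOn ℝ ∞ (c'.bot ∘ c.bot.symm) (c.bot.symm.trans c'.bot).source := by
  rw [← contMDiffOn_iff_contDiffOn]
  refine (contMDiffOn_of_mem_maximalAtlas c'.bot_mem).comp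
    ((contMDiffOn_symm_of_mem_maximalAtlas c.bot_mem).mono ?_) ?_
  · intro z hz
    exact hz.1
  · intro z hz
    exact hz.2

theorem AdaptedChart.dtop_change (c c' : AdaptedChart P) {e : E} (he : e ∈ c.top.source)
    (he' : e ∈ c'.top.source) (X : TangentSpace 𝓘(ℝ, Rn n × Rn k) e) :
    c'.dtop e X = fderiv ℝ (c'.top ∘ c.top.symm) (c.top e) (c.dtop e X) := by
  have hz : c.top e ∈ c.overlap c' := by
    simp [overlap, he, he']
  have h1 := (((c.contDiffOn_top c').contDiffAt
    ((c.isOpen_overlap c').mem_nhds hz)).differentiableAt (by simp)).hasFDerivAt.hasMFDerivAt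
  have h2 := h1.comp e (c.top_mdifferentiable.mdifferentiableAt he).hasMFDerivAt
  have h3 : c'.top =ᶠ[𝓝 e] (c'.top ∘ c.top.symm) ∘ c.top := by
    filter_upwards [c.top.open_source.mem_nhds he] with e' he'
    simp [he']
  have := hasMFDerivAt_unique (c'.top_mdifferentiable.mdifferentiableAt he').hasMFDerivAt
    (h2.congr_of_eventuallyEq h3)
  exact DFunLike.congr_fun this X

theorem AdaptedChart.dbot_change (c c' : AdaptedChart P) {x : M} (hx : x ∈ c.bot.source)
    (hx' : x ∈ c'.bot.source) (X : TangentSpace 𝓘(ℝ, Rn n) x) :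
    c'.dbot x X = fderiv ℝ (c'.bot ∘ c.bot.symm) (c.bot x) (c.dbot x X) := by
  have hz : c.bot x ∈ (c.bot.symm.trans c'.bot).source := by
    simp [hx, hx']
  have h1 := (((c.contDiffOn_bot c').contDiffAt
    ((c.bot.symm.trans c'.bot).open_source.mem_nhds hz)).differentiableAt
      (by simp)).hasFDerivAt.hasMFDerivAt
  have h2 := h1.comp x (c.bot_mdifferentiable.mdifferentiableAt hx).hasMFDerivAt
  have h3 : c'.bot =ᶠ[𝓝 x] (c'.bot ∘ c.bot.symm) ∘ c.bot := by
    filter_upwards [c.bot.open_source.mem_nhds hx] with e' he'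
    simp [he']
  have := hasMFDerivAt_unique (c'.bot_mdifferentiable.mdifferentiableAt hx').hasMFDerivAt
    (h2.congr_of_eventuallyEq h3)
  exact DFunLike.congr_fun this X

end AdaptedChart

/-! ### The jet bundle `J¹π` as a manifold -/

/-- The first jet bundle `J¹π`: pairs of a point `e ∈ E` and a linear right inverse
`τ : T_{π(e)} M → T_e E` of `π_*(e)`. -/
@[ext]
structure Jet (P : FiberedManifold n k M E) where
  base : E
  τ : TangentSpace 𝓘(ℝ, Rn n) (P.proj base) →L[ℝ] TangentSpace 𝓘(ℝ, Rn n × Rn k) base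
  right_inv : ∀ X, P.dproj base (τ X) = X

/-- The space of values of the jet coordinates `((xⁱ, yᴬ), yᴬᵢ)`. -/
abbrev JetModel (n k : ℕ) : Type := (Rn n × Rn k) × (Rn n →L[ℝ] Rn k)

section Jet

variable {P : FiberedManifold n k M E} (c c' : AdaptedChart P)

/-- The jet coordinates `(xⁱ, yᴬ, yᴬᵢ)` induced by adapted coordinates, where
`yᴬᵢ(τ) = dyᴬ(τ(∂/∂xⁱ))`. -/
def AdaptedChart.jetCoord (j : Jet P) : JetModel n k :=
  (c.top j.base, ContinuousLinearMap.snd ℝ (Rn n) (Rn k) ∘L c.dtop j.base ∘L j.τ ∘L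
    (c.dbot (P.proj j.base)).inverse)

theorem AdaptedChart.dtop_jet {j : Jet P} (hj : j.base ∈ c.top.source)
    (X : TangentSpace 𝓘(ℝ, Rn n) (P.proj j.base)) :
    c.dtop j.base (j.τ X) =
      (c.dbot (P.proj j.base) X, (c.jetCoord j).2 (c.dbot (P.proj j.base) X)) := by
  apply Prod.ext
  · rw [← c.dbot_dproj hj, j.right_inv]
  · simp [jetCoord, (c.dbot_isInvertible (c.maps _ hj)).inverse_apply_self]

theorem AdaptedChart.jetCoord_bijOn :
    Set.BijOn c.jetCoord {j | j.base ∈ c.top.source} (c.top.target ×ˢ Set.univ) := by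
  refine ⟨?_, ?_, ?_⟩
  · intro j hj
    exact ⟨c.top.map_source hj, trivial⟩
  · intro j hj j' hj' h
    have hb : j.base = j'.base := c.top.injOn hj hj' (congrArg Prod.fst h)
    have hτ : ∀ X, c.dtop j.base (j.τ X) = _ := fun X => c.dtop_jet hj X
    have hτ' : ∀ X, c.dtop j'.base (j'.τ X) = _ := fun X => c.dtop_jet hj' X
    rw [h] at hτ
    obtain ⟨e, τ, hr⟩ := j
    obtain ⟨e', τ', hr'⟩ := j'
    dsimp only at hb
    subst hb
    congr 1
    ext1 X
    exact (c.dtop_isInvertible hj).injective ((hτ X).trans (hτ' X).symm)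
  · rintro ⟨z, p⟩ ⟨hz, -⟩
    have he : c.top.symm z ∈ c.top.source := c.top.map_target hz
    have hI := c.dtop_isInvertible he
    have hJ := c.dbot_isInvertible (c.maps _ he)
    refine ⟨⟨c.top.symm z, (c.dtop (c.top.symm z)).inverse ∘L
      (ContinuousLinearMap.id ℝ (Rn n)).prod p ∘L c.dbot (P.proj (c.top.symm z)), ?_⟩, he, ?_⟩
    · intro X
      apply hJ.injective
      rw [c.dbot_dproj he]
      simp [hI.self_apply_inverse]
    · apply Prod.ext
      · exact c.top.right_inv hz
      · ext1 w
        simp [jetCoord, hI.self_apply_inverse, hJ.self_apply_inverse]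

/-- The chart of `J¹π` given by jet coordinates (`j₀` only serves to fill in values of the inverse
outside of the domain). -/
def AdaptedChart.jetChart (j₀ : Jet P) : PartialEquiv (Jet P) (JetModel n k) :=
  haveI : Nonempty (Jet P) := ⟨j₀⟩
  Set.BijOn.toPartialEquiv c.jetCoord _ _ c.jetCoord_bijOn

/-- The change of jet coordinates. -/
def AdaptedChart.jetChange (w : JetModel n k) : JetModel n k :=
  ((c'.top ∘ c.top.symm) w.1,
    ContinuousLinearMap.snd ℝ (Rn n) (Rn k) ∘L fderiv ℝ (c'.top ∘ c.top.symm) w.1 ∘L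
      (ContinuousLinearMap.id ℝ (Rn n)).prod w.2 ∘L
      fderiv ℝ (c.bot ∘ c'.bot.symm) ((c'.top ∘ c.top.symm) w.1).1)

theorem AdaptedChart.jetChange_jetCoord {j : Jet P} (hj : j.base ∈ c.top.source)
    (hj' : j.base ∈ c'.top.source) : c.jetChange c' (c.jetCoord j) = c'.jetCoord j := by
  apply Prod.ext
  · simp [jetChange, jetCoord, hj]
  · ext1 w
    have hJ' := c'.dbot_isInvertible (c'.maps _ hj')
    obtain ⟨X, rfl⟩ := hJ'.surjective w
    have h1 := c'.dtop_jet hj' X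
    rw [c.dtop_change c' hj hj', c.dtop_jet hj] at h1
    have h2 := c'.dbot_change c (c'.maps _ hj') (c.maps _ hj) X
    have h3 := congrArg Prod.snd h1
    dsimp only at h3
    rw [← h3, h2]
    simp [jetChange, c'.comm _ hj']
    simp [jetCoord, hj]

theorem AdaptedChart.contDiffOn_jetChange :
    ContDiffOn ℝ ∞ (c.jetChange c') (c.overlap c' ×ˢ Set.univ) := by
  have hfst : Set.MapsTo (Prod.fst : JetModel n k → Rn n × Rn k)
      (c.overlap c' ×ˢ Set.univ) (c.overlap c') := fun w hw => hw.1
  have h1 : ContDiffOn ℝ ∞ (fun w : JetModel n k => (c'.top ∘ c.top.symm) w.1)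
      (c.overlap c' ×ˢ Set.univ) := (c.contDiffOn_top c').comp contDiffOn_fst hfst
  have h2 : ContDiffOn ℝ ∞ (fun w : JetModel n k => fderiv ℝ (c'.top ∘ c.top.symm) w.1)
      (c.overlap c' ×ˢ Set.univ) :=
    ((c.contDiffOn_top c').fderiv_of_isOpen (c.isOpen_overlap c') (by simp)).comp
      contDiffOn_fst hfst
  have h3 : ContDiffOn ℝ ∞ (fun w : JetModel n k =>
      fderiv ℝ (c.bot ∘ c'.bot.symm) ((c'.top ∘ c.top.symm) w.1).1)
      (c.overlap c' ×ˢ Set.univ) := by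
    refine ((c'.contDiffOn_bot c).fderiv_of_isOpen
      (c'.bot.symm.trans c.bot).open_source (by simp)).comp h1.fst ?_
    rintro ⟨z, p⟩ ⟨hz, -⟩
    have he : c.top.symm z ∈ c.top.source := c.top.map_target hz.1
    have he' : c.top.symm z ∈ c'.top.source := hz.2
    have h5 : ((c'.top ∘ c.top.symm) z).1 = c'.bot (P.proj (c.top.symm z)) :=
      (c'.comm _ he').symm
    have h6 := c'.maps _ he'
    have h7 := c.maps _ he
    simp only [h5]
    simp [h6, h7]
  have h4 : ContDiff ℝ ∞ (fun w : JetModel n k =>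
      (ContinuousLinearMap.id ℝ (Rn n)).prod w.2) :=
    (ContinuousLinearMap.prodL (𝕜 := ℝ) (E := Rn n) (F := Rn n) (G := Rn k) ℝ).contDiff.comp
      (contDiff_const.prodMk contDiff_snd)
  exact h1.prodMk (contDiffOn_const.clm_comp (h2.clm_comp (h4.contDiffOn.clm_comp h3)))

theorem AdaptedChart.jetChart_trans_source (j₀ j₀' : Jet P) :
    ((c.jetChart j₀).symm.trans (c'.jetChart j₀')).source = c.overlap c' ×ˢ Set.univ := by
  ext w
  constructor
  · rintro ⟨hw, hw'⟩
    have h1 : ((c.jetChart j₀).symm w).base ∈ c.top.source := (c.jetChart j₀).map_target hw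
    have h2 : c.jetCoord ((c.jetChart j₀).symm w) = w := (c.jetChart j₀).right_inv hw
    have h3 : ((c.jetChart j₀).symm w).base ∈ c'.top.source := hw'
    have h4 : c.top ((c.jetChart j₀).symm w).base = w.1 := congrArg Prod.fst h2
    refine ⟨⟨hw.1, ?_⟩, trivial⟩
    change c.top.symm w.1 ∈ c'.top.source
    rwa [← h4, c.top.left_inv h1]
  · rintro ⟨⟨hw, hw'⟩, -⟩
    have hw0 : w ∈ (c.jetChart j₀).target := ⟨hw, trivial⟩
    have h1 : ((c.jetChart j₀).symm w).base ∈ c.top.source := (c.jetChart j₀).map_target hw0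
    have h2 : c.jetCoord ((c.jetChart j₀).symm w) = w := (c.jetChart j₀).right_inv hw0
    have h4 : c.top ((c.jetChart j₀).symm w).base = w.1 := congrArg Prod.fst h2
    refine ⟨hw0, ?_⟩
    change ((c.jetChart j₀).symm w).base ∈ c'.top.source
    change c.top.symm w.1 ∈ c'.top.source at hw'
    rwa [← h4, c.top.left_inv h1] at hw'

theorem AdaptedChart.jetChart_trans_eqOn (j₀ j₀' : Jet P) :
    Set.EqOn ((c.jetChart j₀).symm.trans (c'.jetChart j₀')) (c.jetChange c')
      (c.overlap c' ×ˢ Set.univ) := by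
  intro w hw
  rw [← c.jetChart_trans_source c' j₀ j₀'] at hw
  have h1 : ((c.jetChart j₀).symm w).base ∈ c.top.source := (c.jetChart j₀).map_target hw.1
  have h2 : c.jetCoord ((c.jetChart j₀).symm w) = w := (c.jetChart j₀).right_inv hw.1
  have h3 := c.jetChange_jetCoord c' h1 hw.2
  rw [h2] at h3
  exact h3.symm

variable [IsManifold 𝓘(ℝ, Rn n × Rn k) ∞ E]

/-- An adapted chart around a point of `E`. -/
def adaptedChartAt (P : FiberedManifold n k M E) (e : E) : AdaptedChart P :=
  (exists_adaptedChart P e).choose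

theorem mem_adaptedChartAt (P : FiberedManifold n k M E) (e : E) :
    e ∈ (adaptedChartAt P e).top.source :=
  (exists_adaptedChart P e).choose_spec

/-- The atlas of `J¹π` consisting of all jet coordinate charts. -/
def jetCore (P : FiberedManifold n k M E) : ChartedSpaceCore (JetModel n k) (Jet P) where
  atlas := {φ | ∃ (c : AdaptedChart P) (j₀ : Jet P), φ = c.jetChart j₀}
  chartAt j := (adaptedChartAt P j.base).jetChart j
  mem_chart_source j := mem_adaptedChartAt P j.base
  chart_mem_atlas j := ⟨_, _, rfl⟩
  open_source := by
    rintro _ _ ⟨c, j₀, rfl⟩ ⟨c', j₀', rfl⟩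
    rw [c.jetChart_trans_source c' j₀ j₀']
    exact (c.isOpen_overlap c').prod isOpen_univ
  continuousOn_toFun := by
    rintro _ _ ⟨c, j₀, rfl⟩ ⟨c', j₀', rfl⟩
    rw [c.jetChart_trans_source c' j₀ j₀']
    exact (c.contDiffOn_jetChange c').continuousOn.congr (c.jetChart_trans_eqOn c' j₀ j₀')

instance instTopologicalSpaceJet : TopologicalSpace (Jet P) := (jetCore P).toTopologicalSpace

instance instChartedSpaceJet : ChartedSpace (JetModel n k) (Jet P) := (jetCore P).toChartedSpace

instance instIsManifoldJet : IsManifold 𝓘(ℝ, JetModel n k) ∞ (Jet P) := by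
  apply isManifold_of_contDiffOn
  intro f f' hf hf'
  obtain ⟨_, ⟨_, rfl⟩, hf⟩ := hf
  obtain ⟨_, ⟨⟨c, j₀, rfl⟩, rfl⟩, rfl⟩ := hf
  obtain ⟨_, ⟨_, rfl⟩, hf'⟩ := hf'
  obtain ⟨_, ⟨⟨c', j₀', rfl⟩, rfl⟩, rfl⟩ := hf'
  have h := (c.contDiffOn_jetChange c').congr (c.jetChart_trans_eqOn c' j₀ j₀')
  rw [← c.jetChart_trans_source c' j₀ j₀'] at h
  refine h.mono ?_
  intro w hw
  exact hw.1

end Jet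

/-! ### The adapted frame bundle `L_π E` as a manifold -/

/-- The adapted frame bundle `L_π E`: an adapted frame at `e ∈ E`, written as the linear
isomorphism `ℝⁿ × ℝᵏ → T_e E` sending the standard basis to the frame `(e_i, e_A)`; the last `k`
basis vectors are vertical. -/
@[ext]
structure AdaptedFrame (P : FiberedManifold n k M E) where
  base : E
  toMap : (Rn n × Rn k) →L[ℝ] TangentSpace 𝓘(ℝ, Rn n × Rn k) base
  bijective : Function.Bijective toMap
  vertical : ∀ y : Rn k, P.dproj base (toMap (0, y)) = 0

/-- The space of values of the frame coordinates `((xⁱ, yᴬ), vⁱⱼ, vᴬⱼ, vᴬ_B)`. -/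
abbrev FrameModel (n k : ℕ) : Type :=
  (Rn n × Rn k) × ((Rn n →L[ℝ] Rn n) × (Rn n →L[ℝ] Rn k) × (Rn k →L[ℝ] Rn k))

/-- The block lower triangular map with the given blocks. -/
def lowerBlock {n k : ℕ} (v : (Rn n →L[ℝ] Rn n) × (Rn n →L[ℝ] Rn k) × (Rn k →L[ℝ] Rn k)) :
    (Rn n × Rn k) →L[ℝ] Rn n × Rn k :=
  (v.1.prod v.2.1) ∘L ContinuousLinearMap.fst ℝ (Rn n) (Rn k) +
    (ContinuousLinearMap.inr ℝ (Rn n) (Rn k) ∘L v.2.2) ∘L ContinuousLinearMap.snd ℝ (Rn n) (Rn k)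

@[simp]
theorem lowerBlock_apply {n k : ℕ}
    (v : (Rn n →L[ℝ] Rn n) × (Rn n →L[ℝ] Rn k) × (Rn k →L[ℝ] Rn k)) (x : Rn n) (y : Rn k) :
    lowerBlock v (x, y) = (v.1 x, v.2.1 x + v.2.2 y) := by
  simp [lowerBlock]

theorem isUnit_iff_bijective {V : Type*} [NormedAddCommGroup V] [NormedSpace ℝ V]
    [FiniteDimensional ℝ V] (f : V →L[ℝ] V) : IsUnit f ↔ Function.Bijective f := by
  have : CompleteSpace V := FiniteDimensional.complete ℝ V
  exact ContinuousLinearMap.isUnit_iff_bijective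

theorem lowerBlock_bijective_iff {n k : ℕ}
    (v : (Rn n →L[ℝ] Rn n) × (Rn n →L[ℝ] Rn k) × (Rn k →L[ℝ] Rn k)) :
    Function.Bijective (lowerBlock v) ↔ IsUnit v.1 ∧ IsUnit v.2.2 := by
  rw [isUnit_iff_bijective, isUnit_iff_bijective]
  constructor
  · intro h
    constructor
    · have hs : Function.Surjective v.1 := by
        intro x
        obtain ⟨⟨x', y'⟩, h'⟩ := h.2 (x, 0)
        rw [lowerBlock_apply] at h'
        exact ⟨x', congrArg Prod.fst h'⟩
      exact ⟨(LinearMap.injective_iff_surjective (f := v.1.toLinearMap)).2 hs, hs⟩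
    · have hi : Function.Injective v.2.2 := by
        intro y y' hy
        have : lowerBlock v (0, y) = lowerBlock v (0, y') := by simp [hy]
        exact congrArg Prod.snd (h.1 this)
      exact ⟨hi, (LinearMap.injective_iff_surjective (f := v.2.2.toLinearMap)).1 hi⟩
  · rintro ⟨ha, hb⟩
    constructor
    · rintro ⟨x, y⟩ ⟨x', y'⟩ h
      rw [lowerBlock_apply, lowerBlock_apply] at h
      have h1 : x = x' := ha.1 (congrArg Prod.fst h)
      subst h1
      have h2 := congrArg Prod.snd h
      simp only [add_right_inj] at h2
      rw [hb.1 h2]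
    · rintro ⟨x, y⟩
      obtain ⟨x', rfl⟩ := ha.2 x
      obtain ⟨y', hy'⟩ := hb.2 (y - v.2.1 x')
      exact ⟨(x', y'), by simp [hy']⟩

section Frame

variable {P : FiberedManifold n k M E} (c c' : AdaptedChart P)

/-- The blocks of a linear endomorphism of `ℝⁿ × ℝᵏ` other than the upper right one. -/
def blocks {n k : ℕ} (w : (Rn n × Rn k) →L[ℝ] Rn n × Rn k) :
    (Rn n →L[ℝ] Rn n) × (Rn n →L[ℝ] Rn k) × (Rn k →L[ℝ] Rn k) :=
  (ContinuousLinearMap.fst ℝ (Rn n) (Rn k) ∘L w ∘L ContinuousLinearMap.inl ℝ (Rn n) (Rn k),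
    ContinuousLinearMap.snd ℝ (Rn n) (Rn k) ∘L w ∘L ContinuousLinearMap.inl ℝ (Rn n) (Rn k),
    ContinuousLinearMap.snd ℝ (Rn n) (Rn k) ∘L w ∘L ContinuousLinearMap.inr ℝ (Rn n) (Rn k))

theorem blocks_lowerBlock {n k : ℕ}
    (v : (Rn n →L[ℝ] Rn n) × (Rn n →L[ℝ] Rn k) × (Rn k →L[ℝ] Rn k)) :
    blocks (lowerBlock v) = v := by
  refine Prod.ext ?_ (Prod.ext ?_ ?_) <;> ext1 <;> simp [blocks]

theorem lowerBlock_blocks {n k : ℕ} (w : (Rn n × Rn k) →L[ℝ] Rn n × Rn k)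
    (hw : ∀ y, (w (0, y)).1 = 0) : lowerBlock (blocks w) = w := by
  refine ContinuousLinearMap.ext fun ⟨x, y⟩ => ?_
  have h : w (x, y) = w (x, 0) + w (0, y) := by simp [← map_add]
  rw [h]
  apply Prod.ext <;> simp [blocks, hw]

/-- The frame coordinates `(xⁱ, yᴬ, vⁱⱼ, vᴬⱼ, vᴬ_B)` induced by adapted coordinates. -/
def AdaptedChart.frameCoord (u : AdaptedFrame P) : FrameModel n k :=
  (c.top u.base, blocks (c.dtop u.base ∘L u.toMap))

theorem AdaptedChart.lowerBlock_frameCoord {u : AdaptedFrame P} (hu : u.base ∈ c.top.source) :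
    lowerBlock (c.frameCoord u).2 = c.dtop u.base ∘L u.toMap := by
  apply lowerBlock_blocks
  intro y
  simp [← c.dbot_dproj hu, u.vertical]

/-- The values of the frame coordinates. -/
def frameUnits (n k : ℕ) :
    Set ((Rn n →L[ℝ] Rn n) × (Rn n →L[ℝ] Rn k) × (Rn k →L[ℝ] Rn k)) :=
  {v | IsUnit v.1 ∧ IsUnit v.2.2}

theorem isOpen_frameUnits (n k : ℕ) : IsOpen (frameUnits n k) :=
  (Units.isOpen.preimage continuous_fst).inter
    (Units.isOpen.preimage (continuous_snd.comp continuous_snd))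

theorem AdaptedChart.frameCoord_bijOn :
    Set.BijOn c.frameCoord {u | u.base ∈ c.top.source} (c.top.target ×ˢ frameUnits n k) := by
  refine ⟨?_, ?_, ?_⟩
  · intro u hu
    refine ⟨c.top.map_source hu, ?_⟩
    change IsUnit _ ∧ IsUnit _
    rw [← lowerBlock_bijective_iff, c.lowerBlock_frameCoord hu]
    exact (c.dtop_isInvertible hu).bijective.comp u.bijective
  · intro u hu u' hu' h
    have hb : u.base = u'.base := c.top.injOn hu hu' (congrArg Prod.fst h)
    have h1 := c.lowerBlock_frameCoord hu
    have h2 := c.lowerBlock_frameCoord hu'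
    rw [h] at h1
    obtain ⟨e, f, hr, hv⟩ := u
    obtain ⟨e', f', hr', hv'⟩ := u'
    dsimp only at hb
    subst hb
    congr 1
    refine ContinuousLinearMap.ext fun X => ?_
    exact (c.dtop_isInvertible hu).injective (DFunLike.congr_fun (h1.symm.trans h2) X)
  · rintro ⟨z, v⟩ ⟨hz, hv⟩
    have he : c.top.symm z ∈ c.top.source := c.top.map_target hz
    have hI := c.dtop_isInvertible he
    have hJ := c.dbot_isInvertible (c.maps _ he)
    refine ⟨⟨c.top.symm z, (c.dtop (c.top.symm z)).inverse ∘L lowerBlock v, ?_, ?_⟩, he, ?_⟩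
    · exact hI.inverse.bijective.comp ((lowerBlock_bijective_iff v).2 hv)
    · intro y
      apply hJ.injective
      rw [c.dbot_dproj he]
      simp [hI.self_apply_inverse]
    · apply Prod.ext
      · exact c.top.right_inv hz
      · change blocks (_ ∘L (_ ∘L _)) = v
        rw [← ContinuousLinearMap.comp_assoc, hI.self_comp_inverse]
        exact blocks_lowerBlock v

/-- The chart of `L_π E` given by frame coordinates (`u₀` only serves to fill in values of the
inverse outside of the domain). -/
def AdaptedChart.frameChart (u₀ : AdaptedFrame P) :
    PartialEquiv (AdaptedFrame P) (FrameModel n k) :=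
  haveI : Nonempty (AdaptedFrame P) := ⟨u₀⟩
  Set.BijOn.toPartialEquiv c.frameCoord _ _ c.frameCoord_bijOn

/-- The change of frame coordinates. -/
def AdaptedChart.frameChange (w : FrameModel n k) : FrameModel n k :=
  ((c'.top ∘ c.top.symm) w.1, blocks (fderiv ℝ (c'.top ∘ c.top.symm) w.1 ∘L lowerBlock w.2))

theorem AdaptedChart.frameChange_frameCoord {u : AdaptedFrame P} (hu : u.base ∈ c.top.source)
    (hu' : u.base ∈ c'.top.source) : c.frameChange c' (c.frameCoord u) = c'.frameCoord u := by
  apply Prod.ext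
  · simp [frameChange, frameCoord, hu]
  · change blocks _ = blocks _
    congr 1
    rw [c.lowerBlock_frameCoord hu]
    refine ContinuousLinearMap.ext fun w => ?_
    exact (c.dtop_change c' hu hu' (u.toMap w)).symm

theorem AdaptedChart.contDiffOn_frameChange :
    ContDiffOn ℝ ∞ (c.frameChange c') (c.overlap c' ×ˢ frameUnits n k) := by
  have hfst : Set.MapsTo (Prod.fst : FrameModel n k → Rn n × Rn k)
      (c.overlap c' ×ˢ frameUnits n k) (c.overlap c') := fun w hw => hw.1
  have h1 : ContDiffOn ℝ ∞ (fun w : FrameModel n k => (c'.top ∘ c.top.symm) w.1)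
      (c.overlap c' ×ˢ frameUnits n k) := (c.contDiffOn_top c').comp contDiffOn_fst hfst
  have h2 : ContDiffOn ℝ ∞ (fun w : FrameModel n k => fderiv ℝ (c'.top ∘ c.top.symm) w.1)
      (c.overlap c' ×ˢ frameUnits n k) :=
    ((c.contDiffOn_top c').fderiv_of_isOpen (c.isOpen_overlap c') (by simp)).comp
      contDiffOn_fst hfst
  have h0 : ContDiff ℝ ∞ (fun w : FrameModel n k => w.2.1.prod w.2.2.1) :=
    (ContinuousLinearMap.prodL (𝕜 := ℝ) (E := Rn n) (F := Rn n) (G := Rn k) ℝ).contDiff.comp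
      ((contDiff_fst.comp contDiff_snd).prodMk
        (contDiff_fst.comp (contDiff_snd.comp contDiff_snd)))
  have h0' : ContDiff ℝ ∞ (fun w : FrameModel n k => w.2.2.2) :=
    contDiff_snd.comp (contDiff_snd.comp contDiff_snd)
  have h3 : ContDiff ℝ ∞ (fun w : FrameModel n k => lowerBlock w.2) :=
    (h0.clm_comp contDiff_const).add
      ((contDiff_const.clm_comp h0').clm_comp contDiff_const)
  have h4 := h2.clm_comp h3.contDiffOn
  exact h1.prodMk ((contDiffOn_const.clm_comp (h4.clm_comp contDiffOn_const)).prodMk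
    ((contDiffOn_const.clm_comp (h4.clm_comp contDiffOn_const)).prodMk
      (contDiffOn_const.clm_comp (h4.clm_comp contDiffOn_const))))

theorem AdaptedChart.frameChart_trans_source (u₀ u₀' : AdaptedFrame P) :
    ((c.frameChart u₀).symm.trans (c'.frameChart u₀')).source =
      c.overlap c' ×ˢ frameUnits n k := by
  ext w
  constructor
  · rintro ⟨hw, hw'⟩
    have h1 : ((c.frameChart u₀).symm w).base ∈ c.top.source := (c.frameChart u₀).map_target hw
    have h2 : c.frameCoord ((c.frameChart u₀).symm w) = w := (c.frameChart u₀).right_inv hw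
    have h3 : ((c.frameChart u₀).symm w).base ∈ c'.top.source := hw'
    have h4 : c.top ((c.frameChart u₀).symm w).base = w.1 := congrArg Prod.fst h2
    refine ⟨⟨hw.1, ?_⟩, hw.2⟩
    change c.top.symm w.1 ∈ c'.top.source
    rwa [← h4, c.top.left_inv h1]
  · rintro ⟨⟨hw, hw'⟩, hv⟩
    have hw0 : w ∈ (c.frameChart u₀).target := ⟨hw, hv⟩
    have h1 : ((c.frameChart u₀).symm w).base ∈ c.top.source := (c.frameChart u₀).map_target hw0
    have h2 : c.frameCoord ((c.frameChart u₀).symm w) = w := (c.frameChart u₀).right_inv hw0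
    have h4 : c.top ((c.frameChart u₀).symm w).base = w.1 := congrArg Prod.fst h2
    refine ⟨hw0, ?_⟩
    change ((c.frameChart u₀).symm w).base ∈ c'.top.source
    change c.top.symm w.1 ∈ c'.top.source at hw'
    rwa [← h4, c.top.left_inv h1] at hw'

theorem AdaptedChart.frameChart_trans_eqOn (u₀ u₀' : AdaptedFrame P) :
    Set.EqOn ((c.frameChart u₀).symm.trans (c'.frameChart u₀')) (c.frameChange c')
      (c.overlap c' ×ˢ frameUnits n k) := by
  intro w hw
  rw [← c.frameChart_trans_source c' u₀ u₀'] at hw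
  have h1 : ((c.frameChart u₀).symm w).base ∈ c.top.source := (c.frameChart u₀).map_target hw.1
  have h2 : c.frameCoord ((c.frameChart u₀).symm w) = w := (c.frameChart u₀).right_inv hw.1
  have h3 := c.frameChange_frameCoord c' h1 hw.2
  rw [h2] at h3
  exact h3.symm

variable [IsManifold 𝓘(ℝ, Rn n × Rn k) ∞ E]

/-- The atlas of `L_π E` consisting of all frame coordinate charts. -/
def frameCore (P : FiberedManifold n k M E) :
    ChartedSpaceCore (FrameModel n k) (AdaptedFrame P) where
  atlas := {φ | ∃ (c : AdaptedChart P) (u₀ : AdaptedFrame P), φ = c.frameChart u₀}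
  chartAt u := (adaptedChartAt P u.base).frameChart u
  mem_chart_source u := mem_adaptedChartAt P u.base
  chart_mem_atlas u := ⟨_, _, rfl⟩
  open_source := by
    rintro _ _ ⟨c, u₀, rfl⟩ ⟨c', u₀', rfl⟩
    rw [c.frameChart_trans_source c' u₀ u₀']
    exact (c.isOpen_overlap c').prod (isOpen_frameUnits n k)
  continuousOn_toFun := by
    rintro _ _ ⟨c, u₀, rfl⟩ ⟨c', u₀', rfl⟩
    rw [c.frameChart_trans_source c' u₀ u₀']
    exact (c.contDiffOn_frameChange c').continuousOn.congr (c.frameChart_trans_eqOn c' u₀ u₀')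

instance instTopologicalSpaceFrame : TopologicalSpace (AdaptedFrame P) :=
  (frameCore P).toTopologicalSpace

instance instChartedSpaceFrame : ChartedSpace (FrameModel n k) (AdaptedFrame P) :=
  (frameCore P).toChartedSpace

instance instIsManifoldFrame : IsManifold 𝓘(ℝ, FrameModel n k) ∞ (AdaptedFrame P) := by
  apply isManifold_of_contDiffOn
  intro f f' hf hf'
  obtain ⟨_, ⟨_, rfl⟩, hf⟩ := hf
  obtain ⟨_, ⟨⟨c, u₀, rfl⟩, rfl⟩, rfl⟩ := hf
  obtain ⟨_, ⟨_, rfl⟩, hf'⟩ := hf'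
  obtain ⟨_, ⟨⟨c', u₀', rfl⟩, rfl⟩, rfl⟩ := hf'
  have h := (c.contDiffOn_frameChange c').congr (c.frameChart_trans_eqOn c' u₀ u₀')
  rw [← c.frameChart_trans_source c' u₀ u₀'] at h
  refine h.mono ?_
  intro w hw
  exact hw.1

end Frame

/-! ### Pointwise linear algebra of the tensors `S_ω` -/

section LinearAlgebra

variable {V T : Type*} [AddCommGroup V] [Module ℝ V]
  [AddCommGroup T] [Module ℝ T] [FiniteDimensional ℝ T]

/-- Given endomorphisms `S_α` of `V` depending linearly on the covector `α` of `T`, and a vector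
`X` of `V`: the map taking a covector `σ` of `V` to the unique vector `(Sσ)(X)` of `T` such that
`α((Sσ)(X)) = σ(S_α(X))` for all `α`. -/
def alongForm (S : Module.Dual ℝ T →ₗ[ℝ] V → V) (X : V) : Module.Dual ℝ V →ₗ[ℝ] T :=
  (Module.evalEquiv ℝ T).symm.toLinearMap ∘ₗ
    { toFun := fun σ => σ ∘ₗ (LinearMap.proj X : (V → V) →ₗ[ℝ] V) ∘ₗ S
      map_add' := fun _ _ => rfl
      map_smul' := fun _ _ => rfl }

theorem apply_alongForm (S : Module.Dual ℝ T →ₗ[ℝ] V → V) (X : V) (σ : Module.Dual ℝ V)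
    (α : Module.Dual ℝ T) : α (alongForm S X σ) = σ (S α X) := by
  simp only [alongForm, LinearMap.comp_apply, LinearEquiv.coe_coe,
    Module.apply_evalEquiv_symm_apply]
  rfl

variable [FiniteDimensional ℝ V]

/-- The tensor `S_ω`: the unique vector `S_ω(X₁, …, Xₙ)` of `V` such that for all `σ`
`σ(S_ω(X₁, …, Xₙ)) = ∑ᵢ ω(p X₁, …, (Sσ)(Xᵢ), …, p Xₙ)`, with `(Sσ)(Xᵢ)` at the `i`-th place. -/
def volumeTensor {n : ℕ} (p : V →ₗ[ℝ] T) (S : Module.Dual ℝ T →ₗ[ℝ] V → V)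
    (vol : T [⋀^Fin n]→ₗ[ℝ] ℝ) (X : Fin n → V) : V :=
  (Module.evalEquiv ℝ V).symm
    (∑ i, vol.toMultilinearMap.toLinearMap (fun l => p (X l)) i ∘ₗ alongForm S (X i))

theorem apply_volumeTensor {n : ℕ} (p : V →ₗ[ℝ] T) (S : Module.Dual ℝ T →ₗ[ℝ] V → V)
    (vol : T [⋀^Fin n]→ₗ[ℝ] ℝ) (X : Fin n → V) (σ : Module.Dual ℝ V) :
    σ (volumeTensor p S vol X) =
      ∑ i, vol (Function.update (fun l => p (X l)) i (alongForm S (X i) σ)) := by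
  simp [volumeTensor, Module.apply_evalEquiv_symm_apply]

end LinearAlgebra

section Geometry

variable [IsManifold 𝓘(ℝ, Rn n × Rn k) ∞ E] {P : FiberedManifold n k M E}

/-- Covectors at `x ∈ M`, in the preferred chart; this only serves to differentiate with respect to
a covector. -/
def cotangentCoord (x : M) :
    Module.Dual ℝ (TangentSpace 𝓘(ℝ, Rn n) x) ≃ₗ[ℝ] (Rn n →L[ℝ] ℝ) :=
  (LinearMap.toContinuousLinearMap : (Rn n →ₗ[ℝ] ℝ) ≃ₗ[ℝ] (Rn n →L[ℝ] ℝ))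

/-! ### The Cartan–Hamilton–Poincaré form on `J¹π` -/

/-- The projection `π₁ : J¹π → M`. -/
abbrev Jet.proj (j : Jet P) : M := P.proj j.base

/-- `(π₁,₀)_*`, where `π₁,₀ : J¹π → E`. -/
def Jet.dbase (j : Jet P) :
    TangentSpace 𝓘(ℝ, JetModel n k) j →L[ℝ] TangentSpace 𝓘(ℝ, Rn n × Rn k) j.base :=
  mfderiv 𝓘(ℝ, JetModel n k) 𝓘(ℝ, Rn n × Rn k) (Jet.base : Jet P → E) j

/-- `(π₁)_*`. -/
def Jet.dproj (j : Jet P) :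
    TangentSpace 𝓘(ℝ, JetModel n k) j →L[ℝ] TangentSpace 𝓘(ℝ, Rn n) j.proj :=
  mfderiv 𝓘(ℝ, JetModel n k) 𝓘(ℝ, Rn n) (Jet.proj : Jet P → M) j

/-- The canonical contact form `ω¹`: `X ↦ v - τ(π_* v)` with `v = (π₁,₀)_* X`. -/
def Jet.contactForm (j : Jet P) :
    TangentSpace 𝓘(ℝ, JetModel n k) j →L[ℝ] TangentSpace 𝓘(ℝ, Rn n × Rn k) j.base :=
  j.dbase - j.τ ∘L P.dproj j.base ∘L j.dbase

theorem Jet.dproj_contactForm (j : Jet P) (X : TangentSpace 𝓘(ℝ, JetModel n k) j) :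
    P.dproj j.base (j.contactForm X) = 0 := by
  simp [contactForm, j.right_inv]

/-- The jet `τ + η ⊗ ξ`, where `η ∈ T*_{π(e)} M` and `ξ ∈ T_e E` is vertical. -/
def Jet.translate (j : Jet P) (ξ : TangentSpace 𝓘(ℝ, Rn n × Rn k) j.base)
    (hξ : P.dproj j.base ξ = 0) (η : TangentSpace 𝓘(ℝ, Rn n) j.proj →L[ℝ] ℝ) : Jet P where
  base := j.base
  τ := j.τ + η.smulRight ξ
  right_inv X := by
    have h := j.right_inv X
    simp [h, hξ]

theorem Jet.translate_zero (j : Jet P) (ξ : TangentSpace 𝓘(ℝ, Rn n × Rn k) j.base)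
    (hξ : P.dproj j.base ξ = 0) : j.translate ξ hξ 0 = j := by
  cases j
  simp [translate]

/-- The vertical lift `η ⊙ ξ` of a vertical vector `ξ`, as a function of `η`: the derivative at `0`
of the affine map `η ↦ τ + η ⊗ ξ`, which takes the value `τ` at `η = 0` by `Jet.translate_zero`. In
jet coordinates it is `ηᵢ ξᴬ ∂/∂yᴬᵢ`. -/
def Jet.verticalLift (j : Jet P) (ξ : TangentSpace 𝓘(ℝ, Rn n × Rn k) j.base)
    (hξ : P.dproj j.base ξ = 0) :
    (Rn n →L[ℝ] ℝ) →L[ℝ] TangentSpace 𝓘(ℝ, JetModel n k) j :=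
  mfderiv 𝓘(ℝ, Rn n →L[ℝ] ℝ) 𝓘(ℝ, JetModel n k)
    (fun η : Rn n →L[ℝ] ℝ => j.translate ξ hξ η) 0

/-- The vector-valued `1`-forms `S_α : X ↦ α ⊙ ω¹(X)` on `J¹π`. -/
def Jet.S (j : Jet P) : Module.Dual ℝ (TangentSpace 𝓘(ℝ, Rn n) j.proj) →ₗ[ℝ]
    TangentSpace 𝓘(ℝ, JetModel n k) j → TangentSpace 𝓘(ℝ, JetModel n k) j where
  toFun α X := j.verticalLift (j.contactForm X) (j.dproj_contactForm X) (cotangentCoord j.proj α)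
  map_add' α β := by
    ext X
    simp
  map_smul' a α := by
    ext X
    simp

/-- The vector-valued `n`-form `S_ω` on `J¹π`. -/
def Jet.Somega (vol : ∀ x : M, TangentSpace 𝓘(ℝ, Rn n) x [⋀^Fin n]→ₗ[ℝ] ℝ) (j : Jet P)
    (X : Fin n → TangentSpace 𝓘(ℝ, JetModel n k) j) : TangentSpace 𝓘(ℝ, JetModel n k) j :=
  volumeTensor j.dproj.toLinearMap j.S (vol j.proj) X

/-- The differential `dℒ` of a function on `J¹π`. -/
def Jet.d (ℒ : Jet P → ℝ) (j : Jet P) : TangentSpace 𝓘(ℝ, JetModel n k) j →L[ℝ] ℝ :=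
  mfderiv 𝓘(ℝ, JetModel n k) 𝓘(ℝ, ℝ) ℒ j

/-- The Cartan–Hamilton–Poincaré `n`-form `Θ_ℒ = ℒ ω + dℒ ∘ S_ω` on `J¹π`. -/
def chpForm (vol : ∀ x : M, TangentSpace 𝓘(ℝ, Rn n) x [⋀^Fin n]→ₗ[ℝ] ℝ) (ℒ : Jet P → ℝ)
    (j : Jet P) (X : Fin n → TangentSpace 𝓘(ℝ, JetModel n k) j) : ℝ :=
  ℒ j * vol j.proj (fun i => j.dproj (X i)) + Jet.d ℒ j (j.Somega vol X)

/-! ### The projection `ρ : L_π E → J¹π` -/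

theorem FiberedManifold.dproj_surjective (P : FiberedManifold n k M E) (e : E) :
    Function.Surjective (P.dproj e) := by
  intro X
  obtain ⟨c, he⟩ := exists_adaptedChart P e
  obtain ⟨Y, hY⟩ := (c.dtop_isInvertible he).surjective (c.dbot (P.proj e) X, 0)
  refine ⟨Y, (c.dbot_isInvertible (c.maps e he)).injective ?_⟩
  rw [c.dbot_dproj he, hY]

/-- The map `x ↦ xⁱ π_*(e_i)`, `ℝⁿ → T_{π(e)} M`. -/
def AdaptedFrame.horizontal (u : AdaptedFrame P) :
    Rn n →L[ℝ] TangentSpace 𝓘(ℝ, Rn n) (P.proj u.base) :=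
  P.dproj u.base ∘L u.toMap ∘L ContinuousLinearMap.inl ℝ (Rn n) (Rn k)

theorem AdaptedFrame.horizontal_bijective (u : AdaptedFrame P) :
    Function.Bijective u.horizontal := by
  have hs : Function.Surjective u.horizontal := by
    intro X
    obtain ⟨Y, rfl⟩ := P.dproj_surjective u.base X
    obtain ⟨⟨x, y⟩, rfl⟩ := u.bijective.2 Y
    refine ⟨x, ?_⟩
    have h : u.toMap (x, y) = u.toMap (x, 0) + u.toMap (0, y) := by simp [← map_add]
    rw [h, map_add, u.vertical]
    simp [horizontal]
  have hd : Module.finrank ℝ (Rn n) =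
      Module.finrank ℝ (TangentSpace 𝓘(ℝ, Rn n) (P.proj u.base)) := rfl
  exact ⟨(LinearMap.injective_iff_surjective_of_finrank_eq_finrank
    (f := u.horizontal.toLinearMap) hd).2 hs, hs⟩

theorem AdaptedFrame.horizontal_isInvertible (u : AdaptedFrame P) :
    u.horizontal.IsInvertible :=
  ⟨show Rn n ≃L[ℝ] Rn n from (LinearEquiv.ofBijective
    (show Rn n →ₗ[ℝ] Rn n from u.horizontal.toLinearMap)
    u.horizontal_bijective).toContinuousLinearEquiv, rfl⟩

/-- `ρ : L_π E → J¹π`, sending a frame `(e_i, e_A)` to the jet `τ` with `τ(π_*(e_i)) = e_i`. -/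
def rho (u : AdaptedFrame P) : Jet P where
  base := u.base
  τ := u.toMap ∘L ContinuousLinearMap.inl ℝ (Rn n) (Rn k) ∘L u.horizontal.inverse
  right_inv X := u.horizontal_isInvertible.self_apply_inverse X

theorem rho_τ (u : AdaptedFrame P) (x : Rn n) :
    (rho u).τ (P.dproj u.base (u.toMap (x, 0))) = u.toMap (x, 0) := by
  have h := u.horizontal_isInvertible.inverse_apply_self x
  exact congrArg (fun z => u.toMap (z, 0)) h

/-- `ρ_*`. -/
def drho (u : AdaptedFrame P) :
    TangentSpace 𝓘(ℝ, FrameModel n k) u →L[ℝ] TangentSpace 𝓘(ℝ, JetModel n k) (rho u) :=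
  mfderiv 𝓘(ℝ, FrameModel n k) 𝓘(ℝ, JetModel n k) (rho : AdaptedFrame P → Jet P) u

/-! ### Structures on `L_π E` -/

/-- The horizontal members `e_i` of a frame. -/
def AdaptedFrame.vec (u : AdaptedFrame P) (i : Fin n) :
    TangentSpace 𝓘(ℝ, Rn n × Rn k) u.base :=
  u.toMap (EuclideanSpace.single i 1, 0)

/-- The right action `u · g` of an invertible block lower triangular `g`. -/
def AdaptedFrame.act (u : AdaptedFrame P) (g : (Rn n × Rn k) →L[ℝ] Rn n × Rn k)
    (hg : Function.Bijective g) (hg' : ∀ y, (g (0, y)).1 = 0) : AdaptedFrame P where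
  base := u.base
  toMap := u.toMap ∘L g
  bijective := u.bijective.comp hg
  vertical y := by
    have : g (0, y) = (0, (g (0, y)).2) := Prod.ext (hg' y) rfl
    rw [ContinuousLinearMap.comp_apply, this, u.vertical]

theorem exp_bijective (ξ : (Rn n × Rn k) →L[ℝ] Rn n × Rn k) :
    Function.Bijective (NormedSpace.exp ξ : (Rn n × Rn k) →L[ℝ] Rn n × Rn k) := by
  let : NormedAlgebra ℚ ((Rn n × Rn k) →L[ℝ] Rn n × Rn k) := NormedAlgebra.restrictScalars ℚ ℝ _
  have : CompleteSpace ((Rn n × Rn k) →L[ℝ] Rn n × Rn k) := FiniteDimensional.complete ℝ _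
  exact (isUnit_iff_bijective _).1 (NormedSpace.isUnit_exp ξ)

theorem exp_lower (ξ : (Rn n × Rn k) →L[ℝ] Rn n × Rn k) (hξ : ∀ y, (ξ (0, y)).1 = 0) (y : Rn k) :
    ((NormedSpace.exp ξ : (Rn n × Rn k) →L[ℝ] Rn n × Rn k) (0, y)).1 = 0 := by
  have : CompleteSpace ((Rn n × Rn k) →L[ℝ] Rn n × Rn k) := FiniteDimensional.complete ℝ _
  have h := NormedSpace.exp_series_hasSum_exp' (𝕂 := ℝ) ξ
  have h1 := (h.mapL (ContinuousLinearMap.apply ℝ (Rn n × Rn k) ((0, y) : Rn n × Rn k))).mapL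
    (ContinuousLinearMap.fst ℝ (Rn n) (Rn k))
  have hp : ∀ (m : ℕ) (y : Rn k), ((ξ ^ m) (0, y)).1 = 0 := by
    intro m
    induction m with
    | zero => intro y; simp
    | succ m ih =>
      intro y
      have : ξ (0, y) = (0, (ξ (0, y)).2) := Prod.ext (hξ y) rfl
      rw [pow_succ, mul_apply_eq_comp, this]
      exact ih _
  have h2 : ∀ m : ℕ, (ContinuousLinearMap.fst ℝ (Rn n) (Rn k))
      ((ContinuousLinearMap.apply ℝ (Rn n × Rn k) ((0, y) : Rn n × Rn k))
        ((m.factorial⁻¹ : ℝ) • ξ ^ m)) = 0 := by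
    intro m
    have h3 := hp m y
    rw [map_smul, map_smul]
    exact (congrArg ((m.factorial⁻¹ : ℝ) • ·) h3).trans (smul_zero _)
  simp only [h2] at h1
  exact h1.unique hasSum_zero

/-- The curve `t ↦ u · exp(t ξ)`, for `ξ` in the Lie algebra of block lower triangular matrices. -/
def AdaptedFrame.expCurve (u : AdaptedFrame P)
    (v : (Rn n →L[ℝ] Rn n) × (Rn n →L[ℝ] Rn k) × (Rn k →L[ℝ] Rn k)) (t : ℝ) : AdaptedFrame P :=
  u.act (NormedSpace.exp (t • lowerBlock v)) (exp_bijective _)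
    (exp_lower _ fun y => by simp)

theorem AdaptedFrame.expCurve_zero (u : AdaptedFrame P)
    (v : (Rn n →L[ℝ] Rn n) × (Rn n →L[ℝ] Rn k) × (Rn k →L[ℝ] Rn k)) : u.expCurve v 0 = u := by
  have h : (NormedSpace.exp ((0 : ℝ) • lowerBlock v) : (Rn n × Rn k) →L[ℝ] Rn n × Rn k) =
      ContinuousLinearMap.id ℝ (Rn n × Rn k) := by
    have h0 : (0 : ℝ) • lowerBlock v = 0 := by
      refine ContinuousLinearMap.ext fun z => ?_
      simp
    rw [h0, NormedSpace.exp_zero]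
    rfl
  cases u
  simp only [expCurve, act, h, ContinuousLinearMap.comp_id]

/-- The fundamental vertical vector field `ξ*(u) = d/dt (u · exp(t ξ))` at `t = 0` (a curve through
`u`, by `AdaptedFrame.expCurve_zero`). -/
def fundamental (v : (Rn n →L[ℝ] Rn n) × (Rn n →L[ℝ] Rn k) × (Rn k →L[ℝ] Rn k))
    (u : AdaptedFrame P) : TangentSpace 𝓘(ℝ, FrameModel n k) u :=
  mfderiv 𝓘(ℝ, ℝ) 𝓘(ℝ, FrameModel n k) (u.expCurve v) 0 (1 : ℝ)

/-- The elementary linear map sending the `i`-th basis vector to the `j`-th one and all others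
to `0`. -/
def elementary {a b : ℕ} (i : Fin a) (j : Fin b) : Rn a →L[ℝ] Rn b :=
  (EuclideanSpace.proj i : Rn a →L[ℝ] ℝ).smulRight (EuclideanSpace.single j (1 : ℝ))

/-- `E*ⁱ_j`, whose flow replaces `e_i` by `e_i + t e_j` to first order. -/
def Ehh (i j : Fin n) (u : AdaptedFrame P) : TangentSpace 𝓘(ℝ, FrameModel n k) u :=
  fundamental (elementary i j, 0, 0) u

/-- `E*ⁱ_B`, whose flow replaces `e_i` by `e_i + t e_B`. -/
def Ehv (i : Fin n) (B : Fin k) (u : AdaptedFrame P) : TangentSpace 𝓘(ℝ, FrameModel n k) u :=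
  fundamental (0, elementary i B, 0) u

/-- `E*ᴬ_B`, whose flow replaces `e_A` by `e_A + t e_B` to first order. -/
def Evv (A B : Fin k) (u : AdaptedFrame P) : TangentSpace 𝓘(ℝ, FrameModel n k) u :=
  fundamental (0, 0, elementary A B) u

/-- `λ_*`, where `λ : L_π E → E`. -/
def AdaptedFrame.dbase (u : AdaptedFrame P) :
    TangentSpace 𝓘(ℝ, FrameModel n k) u →L[ℝ] TangentSpace 𝓘(ℝ, Rn n × Rn k) u.base :=
  mfderiv 𝓘(ℝ, FrameModel n k) 𝓘(ℝ, Rn n × Rn k) (AdaptedFrame.base : AdaptedFrame P → E) u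

/-- `π ∘ λ : L_π E → M`. -/
abbrev AdaptedFrame.proj (u : AdaptedFrame P) : M := P.proj u.base

/-- `(π ∘ λ)_*`. -/
def AdaptedFrame.dproj (u : AdaptedFrame P) :
    TangentSpace 𝓘(ℝ, FrameModel n k) u →L[ℝ] TangentSpace 𝓘(ℝ, Rn n) u.proj :=
  mfderiv 𝓘(ℝ, FrameModel n k) 𝓘(ℝ, Rn n) (AdaptedFrame.proj : AdaptedFrame P → M) u

/-- The soldering form `(θⁱ, θᴬ)`: the components of `λ_* X` in the frame `u`. -/
def AdaptedFrame.solder (u : AdaptedFrame P) :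
    TangentSpace 𝓘(ℝ, FrameModel n k) u →ₗ[ℝ] Rn n × Rn k :=
  (LinearEquiv.ofBijective u.toMap.toLinearMap u.bijective).symm.toLinearMap ∘ₗ
    u.dbase.toLinearMap

/-- A family `B_1, …, B_n` of vector fields on `L_π E` with `λ_*(B_i(u)) = e_i`. The standard
horizontal vector fields `B(r̂_i)` of any linear connection have this property. -/
def IsStandardFamily (B : Fin n → ∀ u : AdaptedFrame P, TangentSpace 𝓘(ℝ, FrameModel n k) u) :
    Prop :=
  ∀ (i : Fin n) (u : AdaptedFrame P), u.dbase (B i u) = u.vec i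

/-- The vector-valued `1`-forms `S̃_α = ((π ∘ λ)^* α)(B_i) E*ⁱ_C ⊗ θᶜ` on `L_π E`. -/
def AdaptedFrame.S (B : Fin n → ∀ u : AdaptedFrame P, TangentSpace 𝓘(ℝ, FrameModel n k) u)
    (u : AdaptedFrame P) : Module.Dual ℝ (TangentSpace 𝓘(ℝ, Rn n) u.proj) →ₗ[ℝ]
    TangentSpace 𝓘(ℝ, FrameModel n k) u → TangentSpace 𝓘(ℝ, FrameModel n k) u where
  toFun α X := ∑ i, ∑ C, (α (u.dproj (B i u)) * (u.solder X).2 C) • Ehv i C u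
  map_add' α β := by
    ext X
    simp [add_mul, add_smul, Finset.sum_add_distrib]
  map_smul' a α := by
    ext X
    simp [mul_assoc, mul_smul, Finset.smul_sum]

/-- The vector-valued `n`-form `S̃_ω` on `L_π E`. -/
def AdaptedFrame.Somega
    (B : Fin n → ∀ u : AdaptedFrame P, TangentSpace 𝓘(ℝ, FrameModel n k) u)
    (vol : ∀ x : M, TangentSpace 𝓘(ℝ, Rn n) x [⋀^Fin n]→ₗ[ℝ] ℝ) (u : AdaptedFrame P)
    (X : Fin n → TangentSpace 𝓘(ℝ, FrameModel n k) u) : TangentSpace 𝓘(ℝ, FrameModel n k) u :=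
  volumeTensor u.dproj.toLinearMap (u.S B) (vol u.proj) X

/-- The differential `dL` of a function on `L_π E`. -/
def AdaptedFrame.d (L : AdaptedFrame P → ℝ) (u : AdaptedFrame P) :
    TangentSpace 𝓘(ℝ, FrameModel n k) u →L[ℝ] ℝ :=
  mfderiv 𝓘(ℝ, FrameModel n k) 𝓘(ℝ, ℝ) L u

/-- A Lagrangian `L` on `L_π E` is lifted if `E*ⁱ_j(L) = 0` and `E*ᴬ_B(L) = 0`. -/
def IsLifted (L : AdaptedFrame P → ℝ) : Prop :=
  (∀ (i j : Fin n) (u : AdaptedFrame P), AdaptedFrame.d L u (Ehh i j u) = 0) ∧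
    ∀ (A B : Fin k) (u : AdaptedFrame P), AdaptedFrame.d L u (Evv A B u) = 0

/-- The form `θ_L = L ω + dL ∘ S̃_ω` on `L_π E`. -/
def frameForm (B : Fin n → ∀ u : AdaptedFrame P, TangentSpace 𝓘(ℝ, FrameModel n k) u)
    (vol : ∀ x : M, TangentSpace 𝓘(ℝ, Rn n) x [⋀^Fin n]→ₗ[ℝ] ℝ) (L : AdaptedFrame P → ℝ)
    (u : AdaptedFrame P) (X : Fin n → TangentSpace 𝓘(ℝ, FrameModel n k) u) : ℝ :=
  L u * vol u.proj (fun i => u.dproj (X i)) + AdaptedFrame.d L u (u.Somega B vol X)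

/-- The pull-back `ρ^* Θ` of an `n`-form `Θ` on `J¹π` to `L_π E`. -/
def rhoPullback (Θ : ∀ j : Jet P, (Fin n → TangentSpace 𝓘(ℝ, JetModel n k) j) → ℝ)
    (u : AdaptedFrame P) (X : Fin n → TangentSpace 𝓘(ℝ, FrameModel n k) u) : ℝ :=
  Θ (rho u) (fun i => drho u (X i))

end Geometry

end

end FieldTheory

end

/-!
In the coordinates `(z, p)` of `J¹π` and `(z, a, b, d)` of `L_π E` induced by an adapted chart, `ρ`
is `(z, a, b, d) ↦ (z, b a⁻¹)`, a submersion whose vertical vectors are exactly the fundamental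
vectors of the block diagonal matrices. A lifted Lagrangian is therefore annihilated by the kernel
of `ρ_*`, and hence is locally a function of `ρ`; smoothness descends because submersions have local
sections.

As for the forms, `ω¹(ρ_* X)` is the vertical part `θᴬ(X) e_A` of `λ_* X`, and `S̃_α(X)` is the
fundamental vector of the lower left block `α(π_* e_i) θᴬ(X)`, which `ρ_*` takes to the vertical
lift of `θᴬ(X) e_A` along `α`. So `ρ_* S̃_α = S_α ρ_*`. Since `S_ω` is built naturally out of `S_α`,
also `ρ_* S̃_ω = S_ω ρ_*`, and `Θ_ℒ` pulls back to `θ_L` by the chain rule `dL = dℒ ∘ ρ_*`.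
-/

noncomputable section

namespace FieldTheory

section Atlas

variable {𝕜 V V' H H' X Y : Type*} [NontriviallyNormedField 𝕜]
  [NormedAddCommGroup V] [NormedSpace 𝕜 V] [TopologicalSpace H] {I : ModelWithCorners 𝕜 V H}
  [NormedAddCommGroup V'] [NormedSpace 𝕜 V'] [TopologicalSpace H'] {I' : ModelWithCorners 𝕜 V' H'}
  [TopologicalSpace X] [ChartedSpace H X] [TopologicalSpace Y] [ChartedSpace H' Y] {m : ℕ∞ω}

theorem contMDiffAt_of_comp_mem_maximalAtlas {e : OpenPartialHomeomorph Y H'}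
    (he : e ∈ IsManifold.maximalAtlas I' m Y) {f : X → Y} {x : X}
    (hf : ∀ᶠ x' in 𝓝 x, f x' ∈ e.source) (hef : ContMDiffAt I I' m (e ∘ f) x) :
    ContMDiffAt I I' m f x := by
  have hsymm : ContMDiffAt I I' m (e.symm ∘ e ∘ f) x :=
    (contMDiffAt_symm_of_mem_maximalAtlas he (e.map_source hf.self_of_nhds)).comp x hef
  exact hsymm.congr_of_eventuallyEq (hf.mono fun _ hx' => (e.left_inv hx').symm)

theorem mfderiv_injective_of_mem_maximalAtlas {e : OpenPartialHomeomorph X H}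
    (he : e ∈ IsManifold.maximalAtlas I 1 X) {x : X} (hx : x ∈ e.source) :
    Function.Injective (mfderiv I I e x) :=
  OpenPartialHomeomorph.MDifferentiable.mfderiv_injective
    ⟨fun _ h => (mdifferentiableAt_of_mem_maximalAtlas he h).mdifferentiableWithinAt,
      fun _ h => (mdifferentiableAt_symm_of_mem_maximalAtlas he h).mdifferentiableWithinAt⟩ hx

theorem mfderiv_apply_mfderiv_of_hasMFDerivAt_comp {e : OpenPartialHomeomorph Y H'}
    (he : e ∈ IsManifold.maximalAtlas I' 1 Y) {f : X → Y} {x : X} {y : Y} (hxy : f x = y)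
    (hf : ∀ᶠ x' in 𝓝 x, f x' ∈ e.source) {A : TangentSpace I x →L[𝕜] V'}
    (hef : HasMFDerivAt I I' (e ∘ f) x A) (ξ : TangentSpace I x) :
    mfderiv I' I' e y (mfderiv I I' f x ξ) = A ξ := by
  subst hxy
  have hsource : f x ∈ e.source := hf.self_of_nhds
  have hsymm : MDifferentiableAt I I' (e.symm ∘ e ∘ f) x :=
    (mdifferentiableAt_symm_of_mem_maximalAtlas he (e.map_source hsource)).comp x
      hef.mdifferentiableAt
  have hf' : MDifferentiableAt I I' f x :=
    hsymm.congr_of_eventuallyEq (hf.mono fun _ hx' => (e.left_inv hx').symm)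
  exact DFunLike.congr_fun (hasMFDerivAt_unique
    ((mdifferentiableAt_of_mem_maximalAtlas he hsource).hasMFDerivAt.comp x hf'.hasMFDerivAt) hef) ξ

end Atlas

section Fibre

variable {V W F G H H' X Y : Type*} [NormedAddCommGroup V] [NormedSpace ℝ V]
  [NormedAddCommGroup W] [NormedSpace ℝ W] [NormedAddCommGroup F] [NormedSpace ℝ F]
  [NormedAddCommGroup G] [NormedSpace ℝ G] [TopologicalSpace H] {I : ModelWithCorners ℝ V H}
  [TopologicalSpace H'] {I' : ModelWithCorners ℝ W H'} [TopologicalSpace X] [ChartedSpace H X]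
  [TopologicalSpace Y] [ChartedSpace H' Y]

theorem comp_eq_of_mfderiv_eq_zero_on_ker {f : X → Y} {L : X → G}
    (hf : MDifferentiable I I' f) (hL : MDifferentiable I 𝓘(ℝ, G) L)
    (hker : ∀ u ξ, mfderiv I I' f u ξ = 0 → mfderiv I 𝓘(ℝ, G) L u ξ = 0)
    {D : Set F} (hD : IsOpen D) (hD' : IsPreconnected D) {γ : F → X}
    (hγ : MDifferentiableOn 𝓘(ℝ, F) I γ D) {y : Y} (hy : ∀ v ∈ D, f (γ v) = y)
    {v w : F} (hv : v ∈ D) (hw : w ∈ D) : L (γ v) = L (γ w) := by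
  have hderiv (v) (hv : v ∈ D) : HasFDerivAt (L ∘ γ) (0 : F →L[ℝ] G) v := by
    have hγv := (hγ.mdifferentiableAt (hD.mem_nhds hv)).hasMFDerivAt
    have hLγ := ((hL (γ v)).hasMFDerivAt.comp v hγv).hasFDerivAt
    have hfγ := ((hf (γ v)).hasMFDerivAt.comp v hγv).congr_of_eventuallyEq
      (f₁ := fun _ => y) (Filter.eventuallyEq_of_mem (hD.mem_nhds hv) fun w hw => (hy w hw).symm)
    refine hLγ.congr_fderiv (ContinuousLinearMap.ext fun ξ => hker (γ v) _ ?_)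
    exact DFunLike.congr_fun (hasMFDerivAt_unique hfγ (hasMFDerivAt_const y v)) ξ
  exact hD.is_const_of_fderiv_eq_zero hD'
    (fun v hv => (hderiv v hv).differentiableAt.differentiableWithinAt)
    (fun v hv => (hderiv v hv).fderiv) hv hw

end Fibre

section Submersion

open Manifold

variable {V W F X Y Z G H : Type*}
  [NormedAddCommGroup V] [NormedSpace ℝ V] [NormedAddCommGroup W] [NormedSpace ℝ W]
  [NormedAddCommGroup F] [NormedSpace ℝ F] [NormedAddCommGroup G] [NormedSpace ℝ G]
  [TopologicalSpace X] [ChartedSpace V X] [TopologicalSpace Y] [ChartedSpace W Y]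
  [TopologicalSpace H] {J : ModelWithCorners ℝ G H} [TopologicalSpace Z] [ChartedSpace H Z]
  {m : ℕ∞ω} {f : X → Y} {x : X}

theorem exists_localTrivialization (hf : IsSubmersionAtOfComplement F 𝓘(ℝ, V) 𝓘(ℝ, W) m f x) :
    ∃ (e : OpenPartialHomeomorph X (Y × F)) (N : Set Y) (D : Set F),
      x ∈ e.source ∧ IsOpen N ∧ IsOpen D ∧ Convex ℝ D ∧ e.target = N ×ˢ D ∧
      (∀ u ∈ e.source, (e u).1 = f u) ∧
      ContMDiffOn (𝓘(ℝ, W).prod 𝓘(ℝ, F)) 𝓘(ℝ, V) m e.symm e.target := by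
  let e₀ : OpenPartialHomeomorph X (Y × F) :=
    hf.domChart ≫ₕ hf.equiv.toHomeomorph.toOpenPartialHomeomorph ≫ₕ
      hf.codChart.symm.prod (OpenPartialHomeomorph.refl F)
  have hcod (u) (hu : u ∈ hf.domChart.source) :
      hf.codChart (f u) = (hf.equiv (hf.domChart u)).1 := by
    have hu' : hf.domChart u ∈ (hf.domChart.extend 𝓘(ℝ, V)).target := by
      simpa using hf.domChart.map_source hu
    simpa [hu] using hf.writtenInCharts hu'
  have hfst (u) (hu : u ∈ hf.domChart.source) : (e₀ u).1 = f u := by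
    simp [e₀, ← hcod u hu, hf.codChart.left_inv (hf.mapsto_domChart_source_codChart_source hu)]
  have htarget (p) (hp : p ∈ e₀.target) : p.1 ∈ hf.codChart.source ∧
      hf.equiv.symm (hf.codChart p.1, p.2) ∈ hf.domChart.target := by
    simpa [e₀] using hp
  have hsymm : ContMDiffOn (𝓘(ℝ, W).prod 𝓘(ℝ, F)) 𝓘(ℝ, V) m e₀.symm e₀.target :=
    (contMDiffOn_symm_of_mem_maximalAtlas hf.domChart_mem_maximalAtlas).comp
      (hf.equiv.symm.contDiff.contMDiff.comp_contMDiffOn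
        (((contMDiffOn_of_mem_maximalAtlas hf.codChart_mem_maximalAtlas).comp
          contMDiff_fst.contMDiffOn fun p hp => (htarget p hp).1).prodMk_space
          contMDiff_snd.contMDiffOn)) fun p hp => (htarget p hp).2
  have hx : x ∈ e₀.source := by
    simp [e₀, hf.mem_domChart_source, ← hcod x hf.mem_domChart_source,
      hf.codChart.map_source hf.mem_codChart_source]
  obtain ⟨N, D', ⟨hN, hxN, hD', hxD, hND'⟩⟩ := mem_nhds_prod_iff'.1
    (e₀.open_target.mem_nhds (e₀.map_source hx))
  obtain ⟨r, hr, hrD⟩ := Metric.isOpen_iff.1 hD' _ hxD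
  have hND : N ×ˢ Metric.ball (e₀ x).2 r ⊆ e₀.target := (Set.prod_mono_right hrD).trans hND'
  exact ⟨e₀ ≫ₕ OpenPartialHomeomorph.ofSet _ (hN.prod Metric.isOpen_ball), N,
    Metric.ball (e₀ x).2 r, ⟨hx, hxN, Metric.mem_ball_self hr⟩, hN, Metric.isOpen_ball,
    convex_ball _ _, by simpa using hND, fun u hu => hfst u hu.1.1, hsymm.mono (by simp)⟩

theorem contMDiffAt_of_comp_isSubmersionAt
    (hf : IsSubmersionAtOfComplement F 𝓘(ℝ, V) 𝓘(ℝ, W) m f x) {g : Y → Z}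
    (hg : ContMDiffAt 𝓘(ℝ, V) J m (g ∘ f) x) : ContMDiffAt 𝓘(ℝ, W) J m g (f x) := by
  obtain ⟨e, N, D, hx, hN, -, -, htarget, hfst, hsymm⟩ := exists_localTrivialization hf
  have hex : (f x, (e x).2) ∈ N ×ˢ D := by
    rw [← htarget, ← hfst x hx]
    exact e.map_source hx
  let s : Y → X := fun y => e.symm (y, (e x).2)
  have hsx : s (f x) = x := by
    simp only [s, ← hfst x hx, e.left_inv hx]
  have hs : ContMDiffAt 𝓘(ℝ, W) 𝓘(ℝ, V) m s (f x) :=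
    (hsymm.contMDiffAt (e.open_target.mem_nhds (htarget ▸ hex))).comp (f x)
      (contMDiffAt_id.prodMk contMDiffAt_const)
  rw [← hsx] at hg
  refine (hg.comp (f x) hs).congr_of_eventuallyEq ?_
  filter_upwards [hN.mem_nhds hex.1] with y hy
  have hy : (y, (e x).2) ∈ e.target := htarget ▸ ⟨hy, hex.2⟩
  simp only [s, Function.comp_apply, ← hfst _ (e.map_target hy), e.right_inv hy]

theorem exists_contMDiffOn_factor_of_isSubmersion (hm : m ≠ 0)
    (hf : IsSubmersionOfComplement F 𝓘(ℝ, V) 𝓘(ℝ, W) m f) {L : X → G}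
    (hL : ContMDiff 𝓘(ℝ, V) 𝓘(ℝ, G) m L)
    (hker : ∀ u ξ, mfderiv 𝓘(ℝ, V) 𝓘(ℝ, W) f u ξ = 0 → mfderiv 𝓘(ℝ, V) 𝓘(ℝ, G) L u ξ = 0)
    (x : X) : ∃ U : Set X, IsOpen U ∧ x ∈ U ∧ IsOpen (f '' U) ∧ ∃ ℓ : Y → G,
      ContMDiffOn 𝓘(ℝ, W) 𝓘(ℝ, G) m ℓ (f '' U) ∧ ∀ u ∈ U, ℓ (f u) = L u := by
  obtain ⟨e, N, D, hx, hN, hD, hconvex, htarget, hfst, hsymm⟩ := exists_localTrivialization (hf x)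
  have hmem {u} (hu : u ∈ e.source) : f u ∈ N ∧ (e u).2 ∈ D := by
    rw [← hfst u hu, ← Set.mem_prod, ← htarget]
    exact e.map_source hu
  have hmem' {y v} (hy : y ∈ N) (hv : v ∈ D) : (y, v) ∈ e.target := htarget ▸ ⟨hy, hv⟩
  have hfsymm {y v} (hy : y ∈ N) (hv : v ∈ D) : f (e.symm (y, v)) = y := by
    rw [← hfst _ (e.map_target (hmem' hy hv)), e.right_inv (hmem' hy hv)]
  have himage : f '' e.source = N := Set.Subset.antisymm
    (Set.image_subset_iff.2 fun u hu => (hmem hu).1)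
    fun y hy => ⟨_, e.map_target (hmem' hy (hmem hx).2), hfsymm hy (hmem hx).2⟩
  refine ⟨e.source, e.open_source, hx, himage ▸ hN, fun y => L (e.symm (y, (e x).2)), ?_, ?_⟩
  · rw [himage]
    exact hL.comp_contMDiffOn (hsymm.comp (contMDiff_id.prodMk contMDiff_const).contMDiffOn
      fun y hy => hmem' hy (hmem hx).2)
  · intro u hu
    have hslice : ContMDiffOn 𝓘(ℝ, F) 𝓘(ℝ, V) m (fun v => e.symm (f u, v)) D :=
      hsymm.comp (contMDiff_const.prodMk contMDiff_id).contMDiffOn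
        fun v hv => hmem' (hmem hu).1 hv
    refine (comp_eq_of_mfderiv_eq_zero_on_ker (hf.contMDiff.mdifferentiable hm)
      (hL.mdifferentiable hm) hker hD hconvex.isPreconnected (hslice.mdifferentiableOn hm)
      (fun v hv => hfsymm (hmem hu).1 hv) (hmem hx).2 (hmem hu).2).trans ?_
    rw [← hfst u hu, Prod.mk.eta, e.left_inv hu]

end Submersion

section Naturality

variable {V V' T : Type*} [AddCommGroup V] [Module ℝ V] [AddCommGroup V'] [Module ℝ V']
  [AddCommGroup T] [Module ℝ T] [FiniteDimensional ℝ T]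
  {S : Module.Dual ℝ T →ₗ[ℝ] V → V} {S' : Module.Dual ℝ T →ₗ[ℝ] V' → V'} {f : V →ₗ[ℝ] V'}

theorem alongForm_comp {X : V} (hS : ∀ α, f (S α X) = S' α (f X)) (σ : Module.Dual ℝ V') :
    alongForm S X (σ ∘ₗ f) = alongForm S' (f X) σ := by
  refine (Module.evalEquiv ℝ T).injective (LinearMap.ext fun α => ?_)
  simp only [Module.evalEquiv_apply, Module.Dual.eval_apply, apply_alongForm, LinearMap.comp_apply,
    hS]

theorem map_volumeTensor [FiniteDimensional ℝ V] [FiniteDimensional ℝ V'] {n : ℕ}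
    {p : V →ₗ[ℝ] T} {p' : V' →ₗ[ℝ] T} (hp : ∀ X, p' (f X) = p X)
    (hS : ∀ α X, f (S α X) = S' α (f X)) (vol : T [⋀^Fin n]→ₗ[ℝ] ℝ) (X : Fin n → V) :
    f (volumeTensor p S vol X) = volumeTensor p' S' vol (fun i => f (X i)) := by
  refine (Module.evalEquiv ℝ V').injective (LinearMap.ext fun σ => ?_)
  have hσ := apply_volumeTensor p S vol X (σ ∘ₗ f)
  simpa only [Module.evalEquiv_apply, Module.Dual.eval_apply, apply_volumeTensor,
    LinearMap.comp_apply, hp, alongForm_comp (hS · _)] using hσ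

end Naturality

section Model

variable {n k : ℕ}

theorem contDiffOn_frameModel_comp_inverse : ContDiffOn ℝ ∞
    (fun w : FrameModel n k => (w.1, w.2.1, w.2.2.1 ∘L Ring.inverse w.2.1, w.2.2.2))
    (Set.univ ×ˢ frameUnits n k) := by
  rintro w ⟨-, ⟨a, ha⟩, -⟩
  have hinv : ContDiffAt ℝ ∞ (fun w : FrameModel n k => Ring.inverse w.2.1) w :=
    (ha ▸ contDiffAt_ringInverse ℝ a : ContDiffAt ℝ ∞ Ring.inverse w.2.1).comp w
      (contDiffAt_fst.comp w contDiffAt_snd)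
  exact (contDiffAt_fst.prodMk ((contDiffAt_fst.comp w contDiffAt_snd).prodMk
    (((by fun_prop : ContDiffAt ℝ ∞ (fun w : FrameModel n k => w.2.2.1) w).clm_comp hinv).prodMk
      (by fun_prop)))).contDiffWithinAt

/-- The change of coordinates `(z, a, b, d) ↦ (z, a, b a⁻¹, d)` of the frame coordinates, which
straightens the projection `ρ`: that is `(z, a, b, d) ↦ (z, b a⁻¹)` in coordinates. -/
def shear (n k : ℕ) : OpenPartialHomeomorph (FrameModel n k) (FrameModel n k) where
  toFun w := (w.1, w.2.1, w.2.2.1 ∘L Ring.inverse w.2.1, w.2.2.2)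
  invFun w := (w.1, w.2.1, w.2.2.1 ∘L w.2.1, w.2.2.2)
  source := Set.univ ×ˢ frameUnits n k
  target := Set.univ ×ˢ frameUnits n k
  map_source' _ hw := hw
  map_target' _ hw := hw
  left_inv' w hw := by
    have h : Ring.inverse w.2.1 ∘L w.2.1 = .id ℝ (Rn n) := Ring.inverse_mul_cancel _ hw.2.1
    simp only [ContinuousLinearMap.comp_assoc, h, ContinuousLinearMap.comp_id]
  right_inv' w hw := by
    have h : w.2.1 ∘L Ring.inverse w.2.1 = .id ℝ (Rn n) := Ring.mul_inverse_cancel _ hw.2.1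
    simp only [ContinuousLinearMap.comp_assoc, h, ContinuousLinearMap.comp_id]
  open_source := isOpen_univ.prod (isOpen_frameUnits n k)
  open_target := isOpen_univ.prod (isOpen_frameUnits n k)
  continuousOn_toFun := contDiffOn_frameModel_comp_inverse.continuousOn
  continuousOn_invFun := by fun_prop

theorem contDiff_shear_symm : ContDiff ℝ ∞ (shear n k).symm := by
  change ContDiff ℝ ∞ fun w : FrameModel n k => (w.1, w.2.1, w.2.2.1 ∘L w.2.1, w.2.2.2)
  fun_prop

/-- The rearrangement `(z, a, p, d) ↦ ((z, p), (a, d))`, which splits the jet coordinates off the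
sheared frame coordinates. -/
def jetSplitting (n k : ℕ) :
    FrameModel n k ≃L[ℝ] JetModel n k × (Rn n →L[ℝ] Rn n) × (Rn k →L[ℝ] Rn k) where
  toFun w := ((w.1, w.2.2.1), w.2.1, w.2.2.2)
  invFun w := (w.1.1, w.2.1, w.1.2, w.2.2)
  map_add' _ _ := rfl
  map_smul' _ _ := rfl
  left_inv _ := rfl
  right_inv _ := rfl

theorem lowerBlock_comp (w v : (Rn n →L[ℝ] Rn n) × (Rn n →L[ℝ] Rn k) × (Rn k →L[ℝ] Rn k)) :
    lowerBlock w ∘L lowerBlock v =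
      lowerBlock (w.1 ∘L v.1, w.2.1 ∘L v.1 + w.2.2 ∘L v.2.1, w.2.2 ∘L v.2.2) := by
  refine ContinuousLinearMap.ext fun ⟨x, y⟩ => ?_
  simp only [ContinuousLinearMap.comp_apply, lowerBlock_apply, map_add, add_assoc,
    add_apply]

end Model

section Coordinates

variable {n k : ℕ} {M E : Type*} [TopologicalSpace M] [ChartedSpace (Rn n) M] [TopologicalSpace E]
  [ChartedSpace (Rn n × Rn k) E] {P : FiberedManifold n k M E} (c : AdaptedChart P)

theorem AdaptedChart.dtop_toMap {u : AdaptedFrame P} (hu : u.base ∈ c.top.source) (x : Rn n)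
    (y : Rn k) : c.dtop u.base (u.toMap (x, y)) =
      ((c.frameCoord u).2.1 x, (c.frameCoord u).2.2.1 x + (c.frameCoord u).2.2.2 y) := by
  rw [← lowerBlock_apply, c.lowerBlock_frameCoord hu]
  rfl

theorem AdaptedChart.frameCoord_mem_frameUnits {u : AdaptedFrame P} (hu : u.base ∈ c.top.source) :
    (c.frameCoord u).2 ∈ frameUnits n k :=
  (c.frameCoord_bijOn.mapsTo hu).2

theorem AdaptedChart.dbot_horizontal {u : AdaptedFrame P} (hu : u.base ∈ c.top.source) (x : Rn n) :
    c.dbot (P.proj u.base) (u.horizontal x) = (c.frameCoord u).2.1 x := by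
  have h := c.dbot_dproj hu (u.toMap (x, 0))
  rw [c.dtop_toMap hu] at h
  exact h

variable [IsManifold 𝓘(ℝ, Rn n × Rn k) ∞ E]

theorem AdaptedChart.jetCoord_rho_comp {u : AdaptedFrame P} (hu : u.base ∈ c.top.source) :
    (c.jetCoord (rho u)).2 ∘L (c.frameCoord u).2.1 = (c.frameCoord u).2.2.1 := by
  ext1 x
  have hτ := c.dtop_jet (j := rho u) hu (u.horizontal x)
  have hsnd := congrArg Prod.snd (hτ.symm.trans
    ((congrArg (c.dtop u.base) (rho_τ u x)).trans (c.dtop_toMap hu x 0)))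
  simp only [map_zero, add_zero] at hsnd
  exact (congrArg (c.jetCoord (rho u)).2 (c.dbot_horizontal hu x).symm).trans hsnd

theorem AdaptedChart.jetCoord_rho {u : AdaptedFrame P} (hu : u.base ∈ c.top.source) :
    c.jetCoord (rho u) =
      ((c.frameCoord u).1, (c.frameCoord u).2.2.1 ∘L Ring.inverse (c.frameCoord u).2.1) := by
  refine Prod.ext rfl ?_
  have hinv : (c.frameCoord u).2.1 ∘L Ring.inverse (c.frameCoord u).2.1 = .id ℝ (Rn n) :=
    Ring.mul_inverse_cancel _ (c.frameCoord_mem_frameUnits hu).1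
  rw [← c.jetCoord_rho_comp hu, ContinuousLinearMap.comp_assoc, hinv, ContinuousLinearMap.comp_id]

/-- The jet coordinates as a chart of `J¹π`; the jet `j₀` fixes the inverse outside of the range. -/
def AdaptedChart.jetHomeo (j₀ : Jet P) : OpenPartialHomeomorph (Jet P) (JetModel n k) :=
  (jetCore P).openPartialHomeomorph (c.jetChart j₀) ⟨c, j₀, rfl⟩

/-- The frame coordinates as a chart of `L_π E`; the frame `u₀` fixes the inverse outside of the
range. -/
def AdaptedChart.frameHomeo (u₀ : AdaptedFrame P) :
    OpenPartialHomeomorph (AdaptedFrame P) (FrameModel n k) :=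
  (frameCore P).openPartialHomeomorph (c.frameChart u₀) ⟨c, u₀, rfl⟩

theorem AdaptedChart.jetHomeo_mem_maximalAtlas (j₀ : Jet P) :
    c.jetHomeo j₀ ∈ IsManifold.maximalAtlas 𝓘(ℝ, JetModel n k) ∞ (Jet P) :=
  IsManifold.subset_maximalAtlas ⟨_, ⟨c.jetChart j₀, rfl⟩, ⟨_, ⟨⟨c, j₀, rfl⟩, rfl⟩, rfl⟩⟩

theorem AdaptedChart.frameHomeo_mem_maximalAtlas (u₀ : AdaptedFrame P) :
    c.frameHomeo u₀ ∈ IsManifold.maximalAtlas 𝓘(ℝ, FrameModel n k) ∞ (AdaptedFrame P) :=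
  IsManifold.subset_maximalAtlas ⟨_, ⟨c.frameChart u₀, rfl⟩, ⟨_, ⟨⟨c, u₀, rfl⟩, rfl⟩, rfl⟩⟩

theorem AdaptedChart.eventually_jet_base_mem_source {j : Jet P} (hj : j.base ∈ c.top.source) :
    ∀ᶠ j' in 𝓝 j, j'.base ∈ c.top.source :=
  (c.jetHomeo j).open_source.mem_nhds hj

theorem AdaptedChart.eventually_frame_base_mem_source {u : AdaptedFrame P}
    (hu : u.base ∈ c.top.source) : ∀ᶠ u' in 𝓝 u, u'.base ∈ c.top.source :=
  (c.frameHomeo u).open_source.mem_nhds hu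

theorem AdaptedChart.contMDiffAt_jetCoord {j : Jet P} (hj : j.base ∈ c.top.source) :
    ContMDiffAt 𝓘(ℝ, JetModel n k) 𝓘(ℝ, JetModel n k) ∞ c.jetCoord j :=
  contMDiffAt_of_mem_maximalAtlas (c.jetHomeo_mem_maximalAtlas j) hj

theorem AdaptedChart.contMDiffAt_frameCoord {u : AdaptedFrame P} (hu : u.base ∈ c.top.source) :
    ContMDiffAt 𝓘(ℝ, FrameModel n k) 𝓘(ℝ, FrameModel n k) ∞ c.frameCoord u :=
  contMDiffAt_of_mem_maximalAtlas (c.frameHomeo_mem_maximalAtlas u) hu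

theorem Jet.contMDiff_base :
    ContMDiff 𝓘(ℝ, JetModel n k) 𝓘(ℝ, Rn n × Rn k) ∞ (Jet.base : Jet P → E) := by
  intro j
  have hj := mem_adaptedChartAt P j.base
  set c := adaptedChartAt P j.base
  exact contMDiffAt_of_comp_mem_maximalAtlas c.top_mem (c.eventually_jet_base_mem_source hj)
    (contDiff_fst.contMDiff.contMDiffAt.comp j (c.contMDiffAt_jetCoord hj))

/-- The differential of the jet coordinates. -/
def AdaptedChart.djetCoord (j : Jet P) :
    TangentSpace 𝓘(ℝ, JetModel n k) j →L[ℝ] JetModel n k :=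
  mfderiv 𝓘(ℝ, JetModel n k) 𝓘(ℝ, JetModel n k) c.jetCoord j

/-- The differential of the frame coordinates. -/
def AdaptedChart.dframeCoord (u : AdaptedFrame P) :
    TangentSpace 𝓘(ℝ, FrameModel n k) u →L[ℝ] FrameModel n k :=
  mfderiv 𝓘(ℝ, FrameModel n k) 𝓘(ℝ, FrameModel n k) c.frameCoord u

theorem AdaptedChart.hasMFDerivAt_jetCoord {j : Jet P} (hj : j.base ∈ c.top.source) :
    HasMFDerivAt 𝓘(ℝ, JetModel n k) 𝓘(ℝ, JetModel n k) c.jetCoord j (c.djetCoord j) :=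
  ((c.contMDiffAt_jetCoord hj).mdifferentiableAt (by simp)).hasMFDerivAt

theorem AdaptedChart.hasMFDerivAt_frameCoord {u : AdaptedFrame P} (hu : u.base ∈ c.top.source) :
    HasMFDerivAt 𝓘(ℝ, FrameModel n k) 𝓘(ℝ, FrameModel n k) c.frameCoord u (c.dframeCoord u) :=
  ((c.contMDiffAt_frameCoord hu).mdifferentiableAt (by simp)).hasMFDerivAt

theorem AdaptedChart.djetCoord_injective {j : Jet P} (hj : j.base ∈ c.top.source) :
    Function.Injective (c.djetCoord j) :=
  mfderiv_injective_of_mem_maximalAtlas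
    (IsManifold.maximalAtlas_subset_of_le (by simp) (c.jetHomeo_mem_maximalAtlas j)) hj

theorem AdaptedChart.dframeCoord_injective {u : AdaptedFrame P} (hu : u.base ∈ c.top.source) :
    Function.Injective (c.dframeCoord u) :=
  mfderiv_injective_of_mem_maximalAtlas
    (IsManifold.maximalAtlas_subset_of_le (by simp) (c.frameHomeo_mem_maximalAtlas u)) hu

end Coordinates

section Submersion

open Manifold

variable {n k : ℕ} {M E : Type*} [TopologicalSpace M] [ChartedSpace (Rn n) M] [TopologicalSpace E]
  [ChartedSpace (Rn n × Rn k) E] [IsManifold 𝓘(ℝ, Rn n × Rn k) ∞ E] {P : FiberedManifold n k M E}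

theorem isSubmersionOfComplement_rho :
    IsSubmersionOfComplement ((Rn n →L[ℝ] Rn n) × (Rn k →L[ℝ] Rn k)) 𝓘(ℝ, FrameModel n k)
      𝓘(ℝ, JetModel n k) ∞ (rho : AdaptedFrame P → Jet P) := by
  intro u
  have hu := mem_adaptedChartAt P u.base
  set c := adaptedChartAt P u.base
  let φ := c.frameHomeo u ≫ₕ shear n k
  have hsource : φ.source ⊆ {u' | u'.base ∈ c.top.source} := fun u' hu' => hu'.1
  have hφ : φ ∈ IsManifold.maximalAtlas 𝓘(ℝ, FrameModel n k) ∞ (AdaptedFrame P) := by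
    refine (IsManifold.mem_maximalAtlas_iff_contMDiffOn φ).2 ⟨?_, ?_⟩
    · exact contDiffOn_frameModel_comp_inverse.contMDiffOn.comp
        ((contMDiffOn_of_mem_maximalAtlas (c.frameHomeo_mem_maximalAtlas u)).mono hsource)
        fun u' hu' => hu'.2
    · exact (contMDiffOn_symm_of_mem_maximalAtlas (c.frameHomeo_mem_maximalAtlas u)).comp
        contDiff_shear_symm.contMDiff.contMDiffOn fun w (hw : w ∈ φ.target) => hw.2
  refine IsSubmersionAtOfComplement.mk_of_charts (jetSplitting n k) φ (c.jetHomeo (rho u))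
    ⟨hu, ⟨trivial, c.frameCoord_mem_frameUnits hu⟩⟩ hu hφ (c.jetHomeo_mem_maximalAtlas _) hsource ?_
  intro w hw
  have hw : w ∈ φ.target := by simpa using hw
  have hu' := hsource (φ.map_target hw)
  refine (c.jetCoord_rho hu').trans ?_
  exact congrArg (fun v => (jetSplitting n k v).1) (φ.right_inv hw)

theorem contMDiff_rho :
    ContMDiff 𝓘(ℝ, FrameModel n k) 𝓘(ℝ, JetModel n k) ∞ (rho : AdaptedFrame P → Jet P) :=
  isSubmersionOfComplement_rho.contMDiff

theorem AdaptedFrame.contMDiff_base : ContMDiff 𝓘(ℝ, FrameModel n k) 𝓘(ℝ, Rn n × Rn k) ∞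
    (AdaptedFrame.base : AdaptedFrame P → E) :=
  Jet.contMDiff_base.comp contMDiff_rho

theorem rho_surjective : Function.Surjective (rho : AdaptedFrame P → Jet P) := by
  intro j
  have hj := mem_adaptedChartAt P j.base
  set c := adaptedChartAt P j.base
  obtain ⟨u, hu, huj⟩ := c.frameCoord_bijOn.surjOn
    (show ((c.jetCoord j).1, 1, (c.jetCoord j).2, 1) ∈ c.top.target ×ˢ frameUnits n k from
      ⟨c.top.map_source hj, isUnit_one, isUnit_one⟩)
  refine ⟨u, c.jetCoord_bijOn.injOn hu hj ?_⟩
  rw [c.jetCoord_rho hu, huj, Ring.inverse_one]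
  rfl

end Submersion

section Product

variable {𝕜 V H X F F' : Type*} [NontriviallyNormedField 𝕜]
  [NormedAddCommGroup V] [NormedSpace 𝕜 V] [TopologicalSpace H] {I : ModelWithCorners 𝕜 V H}
  [TopologicalSpace X] [ChartedSpace H X] [NormedAddCommGroup F] [NormedSpace 𝕜 F]
  [NormedAddCommGroup F'] [NormedSpace 𝕜 F']

theorem hasMFDerivAt_prodMk_space {f : X → F} {g : X → F'} {x : X}
    {df : TangentSpace I x →L[𝕜] F} {dg : TangentSpace I x →L[𝕜] F'}
    (hf : HasMFDerivAt I 𝓘(𝕜, F) f x df) (hg : HasMFDerivAt I 𝓘(𝕜, F') g x dg) :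
    HasMFDerivAt I 𝓘(𝕜, F × F') (fun x' => (f x', g x')) x (df.prod dg) :=
  ⟨hf.1.prodMk hg.1, hf.2.prodMk hg.2⟩

end Product

section Projection

variable {n k : ℕ} {M E : Type*} [TopologicalSpace M] [ChartedSpace (Rn n) M] [TopologicalSpace E]
  [ChartedSpace (Rn n × Rn k) E] [IsManifold 𝓘(ℝ, Rn n × Rn k) ∞ E] {P : FiberedManifold n k M E}

theorem hasMFDerivAt_rho (u : AdaptedFrame P) :
    HasMFDerivAt 𝓘(ℝ, FrameModel n k) 𝓘(ℝ, JetModel n k) (rho : AdaptedFrame P → Jet P) u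
      (drho u) :=
  (contMDiff_rho.mdifferentiableAt (by simp)).hasMFDerivAt

theorem dbase_drho (u : AdaptedFrame P) (X : TangentSpace 𝓘(ℝ, FrameModel n k) u) :
    (rho u).dbase (drho u X) = u.dbase X :=
  (DFunLike.congr_fun ((Jet.contMDiff_base.mdifferentiableAt (by simp)).hasMFDerivAt.comp u
    (hasMFDerivAt_rho u)).mfderiv X).symm

theorem AdaptedFrame.dproj_eq (u : AdaptedFrame P) (X : TangentSpace 𝓘(ℝ, FrameModel n k) u) :
    u.dproj X = P.dproj u.base (u.dbase X) :=
  DFunLike.congr_fun ((P.mdifferentiableAt_proj u.base).hasMFDerivAt.comp u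
    (AdaptedFrame.contMDiff_base.mdifferentiableAt (by simp)).hasMFDerivAt).mfderiv X

theorem Jet.dproj_eq (j : Jet P) (X : TangentSpace 𝓘(ℝ, JetModel n k) j) :
    j.dproj X = P.dproj j.base (j.dbase X) :=
  DFunLike.congr_fun ((P.mdifferentiableAt_proj j.base).hasMFDerivAt.comp j
    (Jet.contMDiff_base.mdifferentiableAt (by simp)).hasMFDerivAt).mfderiv X

theorem dproj_drho (u : AdaptedFrame P) (X : TangentSpace 𝓘(ℝ, FrameModel n k) u) :
    (rho u).dproj (drho u X) = u.dproj X :=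
  ((rho u).dproj_eq _).trans ((congrArg (P.dproj u.base) (dbase_drho u X)).trans
    (u.dproj_eq X).symm)

variable (c : AdaptedChart P)

theorem AdaptedChart.fst_djetCoord_drho {u : AdaptedFrame P} (hu : u.base ∈ c.top.source)
    (X : TangentSpace 𝓘(ℝ, FrameModel n k) u) :
    (c.djetCoord (rho u) (drho u X)).1 = (c.dframeCoord u X).1 := by
  have hjet := hasFDerivAt_fst.hasMFDerivAt.comp u
    ((c.hasMFDerivAt_jetCoord (j := rho u) hu).comp u (hasMFDerivAt_rho u))
  have hframe := hasFDerivAt_fst.hasMFDerivAt.comp u (c.hasMFDerivAt_frameCoord hu)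
  exact DFunLike.congr_fun (hasMFDerivAt_unique hjet hframe) X

theorem AdaptedChart.snd_djetCoord_drho {u : AdaptedFrame P} (hu : u.base ∈ c.top.source)
    (X : TangentSpace 𝓘(ℝ, FrameModel n k) u) :
    (c.djetCoord (rho u) (drho u X)).2 ∘L (c.frameCoord u).2.1 +
      (c.jetCoord (rho u)).2 ∘L (c.dframeCoord u X).2.1 = (c.dframeCoord u X).2.2.1 := by
  have hjet := hasFDerivAt_snd.hasMFDerivAt.comp u
    ((c.hasMFDerivAt_jetCoord (j := rho u) hu).comp u (hasMFDerivAt_rho u))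
  have hframe := hasFDerivAt_snd.hasMFDerivAt.comp u (c.hasMFDerivAt_frameCoord hu)
  have ha := hasFDerivAt_fst.hasMFDerivAt.comp u hframe
  have hb := hasFDerivAt_fst.hasMFDerivAt.comp u
    (hasFDerivAt_snd.hasMFDerivAt.comp u hframe)
  have hpa := (((isBoundedBilinearMap_comp (𝕜 := ℝ)).hasFDerivAt _).hasMFDerivAt.comp u
    (hasMFDerivAt_prodMk_space hjet ha)).congr_of_eventuallyEq
    ((c.eventually_frame_base_mem_source hu).mono fun u' hu' => (c.jetCoord_rho_comp hu').symm)
  have h := DFunLike.congr_fun (hasMFDerivAt_unique hpa hb) X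
  exact (add_comm _ _).trans h

end Projection

/-- The map `blocks`, which reads off the blocks of a block lower triangular map, as a continuous
linear map. -/
def blocksL (n k : ℕ) : ((Rn n × Rn k) →L[ℝ] Rn n × Rn k) →L[ℝ]
    (Rn n →L[ℝ] Rn n) × (Rn n →L[ℝ] Rn k) × (Rn k →L[ℝ] Rn k) where
  toFun := blocks
  map_add' x y := by simp [blocks]
  map_smul' r x := by simp [blocks]
  cont := by
    unfold blocks
    fun_prop

section FundamentalFields

instance instContinuousSMulFrameModel (n k : ℕ) : ContinuousSMul ℝ (FrameModel n k) :=
  IsBoundedSMul.continuousSMul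

variable {n k : ℕ} {M E : Type*} [TopologicalSpace M] [ChartedSpace (Rn n) M] [TopologicalSpace E]
  [ChartedSpace (Rn n × Rn k) E] {P : FiberedManifold n k M E} (c : AdaptedChart P)

theorem AdaptedChart.frameCoord_expCurve {u : AdaptedFrame P} (hu : u.base ∈ c.top.source)
    (v : (Rn n →L[ℝ] Rn n) × (Rn n →L[ℝ] Rn k) × (Rn k →L[ℝ] Rn k)) (t : ℝ) :
    c.frameCoord (u.expCurve v t) =
      (c.top u.base, blocksL n k (lowerBlock (c.frameCoord u).2 ∘L
        (NormedSpace.exp (t • lowerBlock v) : (Rn n × Rn k) →L[ℝ] Rn n × Rn k))) := by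
  rw [c.lowerBlock_frameCoord hu]
  rfl

theorem AdaptedChart.hasDerivAt_frameCoord_expCurve {u : AdaptedFrame P}
    (hu : u.base ∈ c.top.source)
    (v : (Rn n →L[ℝ] Rn n) × (Rn n →L[ℝ] Rn k) × (Rn k →L[ℝ] Rn k)) :
    HasDerivAt (c.frameCoord ∘ u.expCurve v)
      (0, blocks (lowerBlock (c.frameCoord u).2 ∘L lowerBlock v)) 0 := by
  have : CompleteSpace ((Rn n × Rn k) →L[ℝ] Rn n × Rn k) := FiniteDimensional.complete ℝ _
  have hexp : HasDerivAt (fun t : ℝ => NormedSpace.exp (t • lowerBlock v)) (lowerBlock v) 0 := by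
    simpa only [zero_smul ℝ (lowerBlock v), NormedSpace.exp_zero, one_mul] using
      hasDerivAt_exp_smul_const (𝕂 := ℝ) (lowerBlock v) 0
  have hcomp := (hasDerivAt_const (0 : ℝ) (lowerBlock (c.frameCoord u).2)).clm_comp hexp
  rw [ContinuousLinearMap.zero_comp, zero_add] at hcomp
  rw [show c.frameCoord ∘ u.expCurve v = _ from funext (c.frameCoord_expCurve hu v)]
  exact (hasDerivAt_const (0 : ℝ) (c.top u.base)).prodMk
    ((blocksL n k).hasFDerivAt.comp_hasDerivAt (0 : ℝ) hcomp)

variable [IsManifold 𝓘(ℝ, Rn n × Rn k) ∞ E]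

theorem AdaptedChart.dframeCoord_fundamental {u : AdaptedFrame P} (hu : u.base ∈ c.top.source)
    (v : (Rn n →L[ℝ] Rn n) × (Rn n →L[ℝ] Rn k) × (Rn k →L[ℝ] Rn k)) :
    c.dframeCoord u (fundamental v u) =
      (0, (c.frameCoord u).2.1 ∘L v.1,
        (c.frameCoord u).2.2.1 ∘L v.1 + (c.frameCoord u).2.2.2 ∘L v.2.1,
        (c.frameCoord u).2.2.2 ∘L v.2.2) := by
  rw [← blocks_lowerBlock (_ ∘L v.1, _), ← lowerBlock_comp]
  exact (mfderiv_apply_mfderiv_of_hasMFDerivAt_comp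
    (IsManifold.maximalAtlas_subset_of_le (by simp) (c.frameHomeo_mem_maximalAtlas u))
    (u.expCurve_zero v) (Filter.Eventually.of_forall fun _ => hu)
    (c.hasDerivAt_frameCoord_expCurve hu v).hasFDerivAt.hasMFDerivAt (1 : ℝ)).trans
    (one_smul ℝ _)

theorem isLinearMap_fundamental (u : AdaptedFrame P) :
    IsLinearMap ℝ fun v : (Rn n →L[ℝ] Rn n) × (Rn n →L[ℝ] Rn k) × (Rn k →L[ℝ] Rn k) =>
      fundamental v u := by
  have hu := mem_adaptedChartAt P u.base
  set c := adaptedChartAt P u.base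
  refine ⟨fun v w => c.dframeCoord_injective hu ?_, fun r v => c.dframeCoord_injective hu ?_⟩
  · rw [map_add]
    simp only [c.dframeCoord_fundamental hu]
    simp [add_add_add_comm]
  · rw [map_smul]
    simp only [c.dframeCoord_fundamental hu]
    simp

theorem AdaptedChart.djetCoord_verticalLift {j : Jet P} (hj : j.base ∈ c.top.source)
    (ξ : TangentSpace 𝓘(ℝ, Rn n × Rn k) j.base) (hξ : P.dproj j.base ξ = 0)
    (η : Rn n →L[ℝ] ℝ) :
    c.djetCoord j (j.verticalLift ξ hξ η) =
      (0, ContinuousLinearMap.smulRight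
        (η ∘L (show Rn n →L[ℝ] Rn n from (c.dbot (P.proj j.base)).inverse))
        (c.dtop j.base ξ).2) := by
  let D : Rn n →L[ℝ] Rn n := (c.dbot (P.proj j.base)).inverse
  let A : (Rn n →L[ℝ] ℝ) →L[ℝ] JetModel n k :=
    (ContinuousLinearMap.inr ℝ (Rn n × Rn k) (Rn n →L[ℝ] Rn k)) ∘L
      ((ContinuousLinearMap.smulRightL ℝ (Rn n) (Rn k)).flip (c.dtop j.base ξ).2) ∘L
        ((ContinuousLinearMap.compL ℝ (Rn n) (Rn n) ℝ).flip D)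
  have haffine : c.jetCoord ∘ (fun η : Rn n →L[ℝ] ℝ => j.translate ξ hξ η) =
      fun η => c.jetCoord j + A η := by
    funext η
    refine Prod.ext (add_zero (c.top j.base)).symm (ContinuousLinearMap.ext fun x => ?_)
    change (c.dtop j.base (j.τ (D x) + η (D x) • ξ)).2 =
      (c.dtop j.base (j.τ (D x))).2 + η (D x) • (c.dtop j.base ξ).2
    rw [map_add, map_smul]
    rfl
  have hderiv : HasFDerivAt (c.jetCoord ∘ fun η : Rn n →L[ℝ] ℝ => j.translate ξ hξ η) A 0 :=
    haffine ▸ A.hasFDerivAt.const_add _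
  exact mfderiv_apply_mfderiv_of_hasMFDerivAt_comp (X := Rn n →L[ℝ] ℝ)
    (IsManifold.maximalAtlas_subset_of_le (by simp) (c.jetHomeo_mem_maximalAtlas j))
    (j.translate_zero ξ hξ) (Filter.Eventually.of_forall fun _ => hj) hderiv.hasMFDerivAt η

end FundamentalFields

theorem eq_sum_elementary {a b : ℕ} (ξ : Rn a →L[ℝ] Rn b) :
    ξ = ∑ i, ∑ C, (ξ (EuclideanSpace.single i 1)) C • elementary i C := by
  refine ContinuousLinearMap.coe_injective
    ((EuclideanSpace.basisFun (Fin a) ℝ).toBasis.ext fun i => ?_)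
  ext C
  simp [elementary, Finset.sum_apply, Pi.single_apply]

section Intertwining

variable {n k : ℕ} {M E : Type*} [TopologicalSpace M] [ChartedSpace (Rn n) M] [TopologicalSpace E]
  [ChartedSpace (Rn n × Rn k) E] [IsManifold 𝓘(ℝ, Rn n × Rn k) ∞ E] {P : FiberedManifold n k M E}

theorem AdaptedFrame.toMap_solder (u : AdaptedFrame P)
    (X : TangentSpace 𝓘(ℝ, FrameModel n k) u) : u.toMap (u.solder X) = u.dbase X :=
  (LinearEquiv.ofBijective u.toMap.toLinearMap u.bijective).apply_symm_apply (u.dbase X)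

theorem contactForm_drho (u : AdaptedFrame P) (X : TangentSpace 𝓘(ℝ, FrameModel n k) u) :
    (rho u).contactForm (drho u X) = u.toMap (0, (u.solder X).2) := by
  have hsplit : u.dbase X = u.toMap ((u.solder X).1, 0) + u.toMap (0, (u.solder X).2) := by
    rw [← u.toMap_solder X, ← map_add]
    simp
  have hτ : (rho u).τ (P.dproj u.base (u.dbase X)) = u.toMap ((u.solder X).1, 0) := by
    rw [hsplit, map_add, u.vertical, add_zero, rho_τ]
  change (rho u).dbase (drho u X) - (rho u).τ (P.dproj u.base ((rho u).dbase (drho u X))) = _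
  rw [dbase_drho]
  exact sub_eq_of_eq_add' (hsplit.trans (congrArg (· + _) hτ.symm))

theorem AdaptedFrame.S_eq_fundamental
    {B : Fin n → ∀ u : AdaptedFrame P, TangentSpace 𝓘(ℝ, FrameModel n k) u}
    (hB : IsStandardFamily B) (u : AdaptedFrame P)
    (α : Module.Dual ℝ (TangentSpace 𝓘(ℝ, Rn n) u.proj))
    (X : TangentSpace 𝓘(ℝ, FrameModel n k) u) :
    u.S B α X = fundamental (0, (LinearMap.toContinuousLinearMap
      (α ∘ₗ u.horizontal.toLinearMap)).smulRight (u.solder X).2, 0) u := by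
  have hcoeff : ∀ i, α (u.dproj (B i u)) = α (u.horizontal (EuclideanSpace.single i 1)) :=
    fun i => by
      rw [u.dproj_eq, hB i u]
      rfl
  let F : (Rn n →L[ℝ] Rn k) →ₗ[ℝ] TangentSpace 𝓘(ℝ, FrameModel n k) u :=
    (isLinearMap_fundamental u).mk' _ ∘ₗ LinearMap.inr ℝ _ _ ∘ₗ LinearMap.inl ℝ _ _
  let β : Rn n →L[ℝ] Rn k := (LinearMap.toContinuousLinearMap
    (α ∘ₗ u.horizontal.toLinearMap)).smulRight (u.solder X).2
  change ∑ i, ∑ C, (α (u.dproj (B i u)) * (u.solder X).2 C) • F (elementary i C) = F β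
  conv_rhs => rw [eq_sum_elementary β]
  simp only [hcoeff, map_sum, map_smul]
  rfl

theorem AdaptedChart.snd_djetCoord_drho_fundamental (c : AdaptedChart P) {u : AdaptedFrame P}
    (hu : u.base ∈ c.top.source)
    (v : (Rn n →L[ℝ] Rn n) × (Rn n →L[ℝ] Rn k) × (Rn k →L[ℝ] Rn k)) :
    (c.djetCoord (rho u) (drho u (fundamental v u))).2 ∘L (c.frameCoord u).2.1 =
      (c.frameCoord u).2.2.2 ∘L v.2.1 := by
  have h := c.snd_djetCoord_drho hu (fundamental v u)
  rw [c.dframeCoord_fundamental hu, ← ContinuousLinearMap.comp_assoc, c.jetCoord_rho_comp hu,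
    add_comm] at h
  exact add_left_cancel h

theorem drho_S {B : Fin n → ∀ u : AdaptedFrame P, TangentSpace 𝓘(ℝ, FrameModel n k) u}
    (hB : IsStandardFamily B) (u : AdaptedFrame P)
    (α : Module.Dual ℝ (TangentSpace 𝓘(ℝ, Rn n) u.proj))
    (X : TangentSpace 𝓘(ℝ, FrameModel n k) u) :
    drho u (u.S B α X) = (rho u).S α (drho u X) := by
  have hu := mem_adaptedChartAt P u.base
  set c := adaptedChartAt P u.base
  have ha := c.frameCoord_mem_frameUnits hu
  have hcontact : (c.dtop u.base ((rho u).contactForm (drho u X))).2 =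
      (c.frameCoord u).2.2.2 (u.solder X).2 := by
    refine (congrArg (fun z => (c.dtop u.base z).2) (contactForm_drho u X)).trans ?_
    rw [c.dtop_toMap hu]
    simp
  have hfst : (c.djetCoord (rho u) (drho u (u.S B α X))).1 = 0 := by
    rw [c.fst_djetCoord_drho hu, u.S_eq_fundamental hB, c.dframeCoord_fundamental hu]
  refine c.djetCoord_injective (j := rho u) hu
    (Eq.trans ?_ (c.djetCoord_verticalLift (j := rho u) hu _ _ _).symm)
  refine Prod.ext hfst (ContinuousLinearMap.ext fun w => ?_)
  obtain ⟨y, rfl⟩ : ∃ y, (c.frameCoord u).2.1 y = w := ((isUnit_iff_bijective _).1 ha.1).2 w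
  have hinv : (c.dbot (P.proj u.base)).inverse ((c.frameCoord u).2.1 y) = u.horizontal y := by
    rw [← c.dbot_horizontal hu, (c.dbot_isInvertible (c.maps _ hu)).inverse_apply_self]
  rw [u.S_eq_fundamental hB]
  refine (DFunLike.congr_fun (c.snd_djetCoord_drho_fundamental hu _) y).trans ?_
  change (c.frameCoord u).2.2.2 (α (u.horizontal y) • (u.solder X).2) =
    α ((c.dbot (P.proj u.base)).inverse ((c.frameCoord u).2.1 y)) •
      (c.dtop u.base ((rho u).contactForm (drho u X))).2
  rw [hinv, hcontact, map_smul]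

theorem drho_Somega {B : Fin n → ∀ u : AdaptedFrame P, TangentSpace 𝓘(ℝ, FrameModel n k) u}
    (hB : IsStandardFamily B) (vol : ∀ x : M, TangentSpace 𝓘(ℝ, Rn n) x [⋀^Fin n]→ₗ[ℝ] ℝ)
    (u : AdaptedFrame P) (X : Fin n → TangentSpace 𝓘(ℝ, FrameModel n k) u) :
    drho u (u.Somega B vol X) = (rho u).Somega vol (fun i => drho u (X i)) :=
  map_volumeTensor (f := (drho u).toLinearMap) (dproj_drho u) (drho_S hB u) (vol u.proj) X

theorem d_eq_of_eventually_comp_rho {ℒ : Jet P → ℝ} {L : AdaptedFrame P → ℝ} {u : AdaptedFrame P}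
    (hℒ : MDifferentiableAt 𝓘(ℝ, JetModel n k) 𝓘(ℝ, ℝ) ℒ (rho u))
    (h : ∀ᶠ u' in 𝓝 u, ℒ (rho u') = L u') (X : TangentSpace 𝓘(ℝ, FrameModel n k) u) :
    AdaptedFrame.d L u X = Jet.d ℒ (rho u) (drho u X) :=
  DFunLike.congr_fun ((hℒ.hasMFDerivAt.comp u (hasMFDerivAt_rho u)).congr_of_eventuallyEq
    (h.mono fun _ h' => h'.symm)).mfderiv X

theorem rhoPullback_chpForm {B : Fin n → ∀ u : AdaptedFrame P, TangentSpace 𝓘(ℝ, FrameModel n k) u}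
    (hB : IsStandardFamily B) (vol : ∀ x : M, TangentSpace 𝓘(ℝ, Rn n) x [⋀^Fin n]→ₗ[ℝ] ℝ)
    {ℒ : Jet P → ℝ} {L : AdaptedFrame P → ℝ} {u : AdaptedFrame P}
    (hℒ : MDifferentiableAt 𝓘(ℝ, JetModel n k) 𝓘(ℝ, ℝ) ℒ (rho u))
    (h : ∀ᶠ u' in 𝓝 u, ℒ (rho u') = L u') :
    rhoPullback (chpForm vol ℒ) u = frameForm B vol L u := by
  funext X
  simp only [rhoPullback, chpForm, frameForm, dproj_drho, d_eq_of_eventually_comp_rho hℒ h,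
    drho_Somega hB, h.self_of_nhds]
  rfl

end Intertwining

section Vertical

variable {n k : ℕ} {M E : Type*} [TopologicalSpace M] [ChartedSpace (Rn n) M] [TopologicalSpace E]
  [ChartedSpace (Rn n × Rn k) E] [IsManifold 𝓘(ℝ, Rn n × Rn k) ∞ E] {P : FiberedManifold n k M E}

theorem exists_fundamental_of_drho_eq_zero {u : AdaptedFrame P}
    {X : TangentSpace 𝓘(ℝ, FrameModel n k) u} (hX : drho u X = 0) :
    ∃ ξ ζ, X = fundamental (ξ, 0, ζ) u := by
  have hu := mem_adaptedChartAt P u.base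
  set c := adaptedChartAt P u.base
  obtain ⟨ha, hd⟩ := c.frameCoord_mem_frameUnits hu
  have hz : (c.dframeCoord u X).1 = 0 := by
    rw [← c.fst_djetCoord_drho hu, hX, map_zero]
    rfl
  have hb : (c.jetCoord (rho u)).2 ∘L (c.dframeCoord u X).2.1 = (c.dframeCoord u X).2.2.1 := by
    rw [← c.snd_djetCoord_drho hu, hX, map_zero]
    exact (zero_add _).symm
  have ha' : (c.frameCoord u).2.1 ∘L Ring.inverse (c.frameCoord u).2.1 = .id ℝ (Rn n) :=
    Ring.mul_inverse_cancel _ ha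
  have hd' : (c.frameCoord u).2.2.2 ∘L Ring.inverse (c.frameCoord u).2.2.2 = .id ℝ (Rn k) :=
    Ring.mul_inverse_cancel _ hd
  refine ⟨Ring.inverse (c.frameCoord u).2.1 ∘L (c.dframeCoord u X).2.1,
    Ring.inverse (c.frameCoord u).2.2.2 ∘L (c.dframeCoord u X).2.2.2,
    c.dframeCoord_injective hu ?_⟩
  rw [c.dframeCoord_fundamental hu, ← c.jetCoord_rho_comp hu]
  simp only [ContinuousLinearMap.comp_zero, add_zero, ContinuousLinearMap.comp_assoc]
  simp only [← ContinuousLinearMap.comp_assoc _ (Ring.inverse _), ha', hd',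
    ContinuousLinearMap.id_comp, hb]
  exact Prod.ext hz rfl

theorem IsLifted.d_fundamental {L : AdaptedFrame P → ℝ} (hL : IsLifted L) (u : AdaptedFrame P)
    (ξ : Rn n →L[ℝ] Rn n) (ζ : Rn k →L[ℝ] Rn k) :
    AdaptedFrame.d L u (fundamental (ξ, 0, ζ) u) = 0 := by
  let D : (Rn n →L[ℝ] Rn n) × (Rn n →L[ℝ] Rn k) × (Rn k →L[ℝ] Rn k) →ₗ[ℝ] ℝ :=
    (AdaptedFrame.d L u).toLinearMap ∘ₗ (isLinearMap_fundamental u).mk' _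
  have hξ : D (ξ, 0, 0) = 0 := by
    change (D ∘ₗ LinearMap.inl ℝ _ _) ξ = 0
    rw [eq_sum_elementary ξ]
    simp only [map_sum, map_smul]
    exact Finset.sum_eq_zero fun i _ => Finset.sum_eq_zero fun j _ =>
      (congrArg _ (hL.1 i j u)).trans (smul_zero _)
  have hζ : D (0, 0, ζ) = 0 := by
    change (D ∘ₗ LinearMap.inr ℝ _ _ ∘ₗ LinearMap.inr ℝ _ _) ζ = 0
    rw [eq_sum_elementary ζ]
    simp only [map_sum, map_smul]
    exact Finset.sum_eq_zero fun A _ => Finset.sum_eq_zero fun B _ =>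
      (congrArg _ (hL.2 A B u)).trans (smul_zero _)
  have hsum : ((ξ, 0, ζ) : (Rn n →L[ℝ] Rn n) × (Rn n →L[ℝ] Rn k) × (Rn k →L[ℝ] Rn k)) =
      (ξ, 0, 0) + (0, 0, ζ) := by simp
  change D (ξ, 0, ζ) = 0
  rw [hsum, map_add, hξ, hζ, add_zero]

theorem IsLifted.d_eq_zero_of_drho_eq_zero {L : AdaptedFrame P → ℝ} (hL : IsLifted L)
    {u : AdaptedFrame P} {X : TangentSpace 𝓘(ℝ, FrameModel n k) u} (hX : drho u X = 0) :
    AdaptedFrame.d L u X = 0 := by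
  obtain ⟨ξ, ζ, rfl⟩ := exists_fundamental_of_drho_eq_zero hX
  exact hL.d_fundamental u ξ ζ

end Vertical

end FieldTheory

end

theorem mainTheorem6 {n k : ℕ} {M E : Type*}
    [TopologicalSpace M] [ChartedSpace (FieldTheory.Rn n) M]
    [IsManifold 𝓘(ℝ, FieldTheory.Rn n) ∞ M]
    [TopologicalSpace E] [ChartedSpace (FieldTheory.Rn n × FieldTheory.Rn k) E]
    [IsManifold 𝓘(ℝ, FieldTheory.Rn n × FieldTheory.Rn k) ∞ E]
    (P : FieldTheory.FiberedManifold n k M E)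
    (vol : ∀ x : M, TangentSpace 𝓘(ℝ, FieldTheory.Rn n) x [⋀^Fin n]→ₗ[ℝ] ℝ)
    (B : Fin n → ∀ u : FieldTheory.AdaptedFrame P,
      TangentSpace 𝓘(ℝ, FieldTheory.FrameModel n k) u)
    (hB : FieldTheory.IsStandardFamily B)
    (L : FieldTheory.AdaptedFrame P → ℝ)
    (hL : ContMDiff 𝓘(ℝ, FieldTheory.FrameModel n k) 𝓘(ℝ, ℝ) ∞ L)
    (hlift : FieldTheory.IsLifted L) :
    (∀ ℒ : FieldTheory.Jet P → ℝ, (∀ u, ℒ (FieldTheory.rho u) = L u) →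
      ContMDiff 𝓘(ℝ, FieldTheory.JetModel n k) 𝓘(ℝ, ℝ) ∞ ℒ ∧
      FieldTheory.rhoPullback (FieldTheory.chpForm vol ℒ) = FieldTheory.frameForm B vol L) ∧
    ((∀ u u' : FieldTheory.AdaptedFrame P,
        FieldTheory.rho u = FieldTheory.rho u' → L u = L u') →
      ∃! ℒ : FieldTheory.Jet P → ℝ, ∀ u, ℒ (FieldTheory.rho u) = L u) ∧
    (∀ u₀ : FieldTheory.AdaptedFrame P, ∃ U : Set (FieldTheory.AdaptedFrame P),
      IsOpen U ∧ u₀ ∈ U ∧ IsOpen (FieldTheory.rho '' U) ∧ ∃ ℒ : FieldTheory.Jet P → ℝ,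
        ContMDiffOn 𝓘(ℝ, FieldTheory.JetModel n k) 𝓘(ℝ, ℝ) ∞ ℒ (FieldTheory.rho '' U) ∧
        (∀ u ∈ U, ℒ (FieldTheory.rho u) = L u) ∧
        ∀ u ∈ U, FieldTheory.rhoPullback (FieldTheory.chpForm vol ℒ) u =
          FieldTheory.frameForm B vol L u) := by
  refine ⟨fun ℒ hℒ => ?_, fun hfib => ?_, fun u₀ => ?_⟩
  · have hsmooth : ContMDiff 𝓘(ℝ, FieldTheory.JetModel n k) 𝓘(ℝ, ℝ) ∞ ℒ := by
      intro j
      obtain ⟨u, rfl⟩ := FieldTheory.rho_surjective j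
      refine FieldTheory.contMDiffAt_of_comp_isSubmersionAt
        (FieldTheory.isSubmersionOfComplement_rho u) ?_
      rw [show ℒ ∘ FieldTheory.rho = L from funext hℒ]
      exact hL u
    exact ⟨hsmooth, funext fun u => FieldTheory.rhoPullback_chpForm hB vol
      (hsmooth.mdifferentiableAt (by simp)) (Filter.Eventually.of_forall hℒ)⟩
  · exact ⟨fun j => L (Function.surjInv FieldTheory.rho_surjective j),
      fun u => hfib _ _ (Function.surjInv_eq FieldTheory.rho_surjective (FieldTheory.rho u)),
      fun ℒ hℒ => funext fun j => by
        rw [← hℒ, Function.surjInv_eq FieldTheory.rho_surjective]⟩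
  · obtain ⟨U, hU, hu₀, hρU, ℒ, hsm, hℒ⟩ :=
      FieldTheory.exists_contMDiffOn_factor_of_isSubmersion
        (by simp) FieldTheory.isSubmersionOfComplement_rho hL
        (fun u X => hlift.d_eq_zero_of_drho_eq_zero) u₀
    exact ⟨U, hU, hu₀, hρU, ℒ, hsm, hℒ, fun u hu => FieldTheory.rhoPullback_chpForm hB vol
      ((hsm.contMDiffAt (hρU.mem_nhds ⟨u, hu, rfl⟩)).mdifferentiableAt (by simp))
      (Filter.mem_of_superset (hU.mem_nhds hu) hℒ)⟩
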